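/- Let $\theta(q)=1+2\sum_{k\ge1}q^{k^2}$ and, for integers $m\ge0$, let $$U_{2m}(q)=\frac{\sum_{k\ge0}(-1)^k(2k+1)^{2m+1}q^{k(k+1)/2}}{\sum_{k\ge0}(-1)^k(2k+1)q^{k(k+1)/2}},\qquad \Omega(X)=\sum_{m\ge0}U_{2m}(q)\frac{X^{2m}}{(2m+1)!}$$ ($U_{2m}(q)$ are Ramanujan's series, taken as formal power series in $q$, and $\Omega(X)$ is a formal power series in $X$ over $\mathbb C[[q]]$). Define the power series $Y_n(q)$, $n\ge0$, by $$\sum_{n\ge0}Y_n(q)\frac{X^n}{n!}=\exp\!\left(\frac{\theta(q)^2X}{2}\right)\cdot\Omega\!\left(\frac X2\right).$$ Then for every integer $n\ge0$ the following hold. (1) $Y_n(q)=\frac1{n+1}+O(q)$, and $Y_n(q)$ is a weight $n$ quasimodular form on $\Gamma_0(4)$. Here weight $n$ on $\Gamma_0(4)$ is understood with the character $\chi_{-4}^n$ (the character of $\theta^{2n}$, which is trivial for even $n$), where $\chi_{-4}$ is the nontrivial Dirichlet character modulo $4$. Explicitly, with $q=e^{2\pi i\tau}$ the series $Y_n(q)$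 converges for all $\tau$ in the upper half-plane $\mathbb H$, and there are $p\ge0$ and holomorphic functions $f_0,\dots,f_p$ on $\mathbb H$ with $f_0(\tau)=Y_n(e^{2\pi i\tau})$ such that $F(\tau)=\sum_{r=0}^p f_r(\tau)(\operatorname{Im}\tau)^{-r}$ satisfies $$F\!\left(\frac{a\tau+b}{c\tau+d}\right)=\chi_{-4}(d)^n(c\tau+d)^nF(\tau)\quad\text{for all }\begin{pmatrix}a&b\\c&d\end{pmatrix}\in\Gamma_0(4),$$ and, for every $\begin{pmatrix}a&b\\c&d\end{pmatrix}\in\mathrm{SL}_2(\mathbb Z)$, the function $(c\tau+d)^{-n}F\!\left(\frac{a\tau+b}{c\tau+d}\right)$ is bounded as $\operatorname{Im}\tau\to\infty$. (2) $$Y_n(q)=\frac1{2^n(n+1)}\sum_{k=0}^{\lfloor n/2\rfloor}\binom{n+1}{2k+1}\theta(q)^{2n-4k}\,U_{2k}(q).$$ -/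

import Mathlib

open scoped PowerSeries UpperHalfPlane ModularForm MatrixGroups Manifold

noncomputable section

namespace QuasiTheta

/-- The theta series `θ(q) = 1 + 2q + 2q^4 + 2q^9 + ⋯`, as a formal power series in `q`. -/
def theta : ℂ⟦X⟧ :=
  PowerSeries.mk fun m => if m = 0 then 1 else if IsSquare m then 2 else 0

/-- The formal power series `∑_{k ≥ 0} (-1)^k (2k+1)^s q^{k(k+1)/2}`.  Since `k ≤ k(k+1)/2`, only
the indices `k ≤ m` can contribute to the coefficient of `q^m`. -/
def oddPowerSum (s : ℕ) : ℂ⟦X⟧ :=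
  PowerSeries.mk fun m =>
    ∑ k ∈ Finset.range (m + 1),
      if k * (k + 1) / 2 = m then (-1 : ℂ) ^ k * (2 * (k : ℂ) + 1) ^ s else 0

/-- Ramanujan's series `U_m(q)`, used for even `m` only: the quotient of
`∑ (-1)^k (2k+1)^{m+1} q^{k(k+1)/2}` by `∑ (-1)^k (2k+1) q^{k(k+1)/2}`.  The denominator has
constant term `1`, so the inverse is a genuine one. -/
def ramanujanU (m : ℕ) : ℂ⟦X⟧ :=
  oddPowerSum (m + 1) * (oddPowerSum 1)⁻¹

/-- `Ω(X) = ∑_{t ≥ 0} U_{2t}(q) X^{2t} / (2t+1)!`, a power series in `X` whose coefficients are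
power series in `q`. -/
def Omega : ℂ⟦X⟧⟦X⟧ :=
  PowerSeries.mk fun m =>
    if Even m then PowerSeries.C (1 / ((m + 1).factorial : ℂ)) * ramanujanU m else 0

/-- `exp(θ(q)^2 X / 2) · Ω(X / 2)`, a power series in `X` over the power series in `q`. -/
def generatingSeries : ℂ⟦X⟧⟦X⟧ :=
  PowerSeries.rescale (PowerSeries.C (1 / 2 : ℂ) * theta ^ 2) (PowerSeries.exp ℂ⟦X⟧) *
    PowerSeries.rescale (PowerSeries.C (1 / 2 : ℂ)) Omega

/-- `Y_n(q)`: `n!` times the coefficient of `X^n` in `exp(θ(q)^2 X / 2) · Ω(X / 2)`. -/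
def Y (n : ℕ) : ℂ⟦X⟧ :=
  (n.factorial : ℂ⟦X⟧) * PowerSeries.coeff n generatingSeries

/-- `f` is a quasimodular form of weight `k` on `Γ₀(N)` with character `χ`: it is the constant term
`f₀` of an almost holomorphic modular form `F(τ) = ∑_{r=0}^p f_r(τ) / (Im τ)^r`, where the `f_r` are
holomorphic on the upper half-plane, `F ∣[k] γ = χ(d) F` for every `γ = (a, b; c, d)` in `Γ₀(N)`,
and `F` is bounded at every cusp, that is, `F ∣[k] γ` is bounded at `i∞` for all `γ` in
`SL(2, ℤ)`. -/
def IsQuasimodularForm (N : ℕ) (χ : DirichletCharacter ℂ N) (k : ℤ) (f : ℍ → ℂ) : Prop :=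
  ∃ (p : ℕ) (g : ℕ → ℍ → ℂ) (F : ℍ → ℂ),
    g 0 = f ∧
    (∀ r, MDifferentiable 𝓘(ℂ) 𝓘(ℂ) (g r)) ∧
    (∀ τ : ℍ, F τ = ∑ r ∈ Finset.range (p + 1), g r τ / (τ.im : ℂ) ^ r) ∧
    (∀ γ ∈ CongruenceSubgroup.Gamma0 N, F ∣[k] γ = χ ((γ 1 1 : ℤ) : ZMod N) • F) ∧
    (∀ γ : SL(2, ℤ), UpperHalfPlane.IsBoundedAtImInfty (F ∣[k] γ))

/-- The character modulo `4` of `θ²`: the nontrivial Dirichlet character modulo `4`, with complex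
values. -/
def chi4 : DirichletCharacter ℂ 4 :=
  ZMod.χ₄.ringHomComp (Int.castRingHom ℂ)

/-- The formal `q`-series `A` is a weight `n` quasimodular form on `Γ₀(4)`: with `q = e^{2πiτ}` it
converges on the upper half-plane, and its sum is quasimodular of weight `n`, with the character
`χ₋₄^n`.  This character is the usual convention for integral weight `n` on `Γ₀(4)` in the setting
of half-integral weight: forms of weight `n` transform like `θ^{2n}`.  It is trivial for even `n`,
and for odd `n` no nonzero form has trivial character since `-1 ∈ Γ₀(4)`. -/
def IsQuasimodularGamma0Four (n : ℕ) (A : ℂ⟦X⟧) : Prop :=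
  ∃ f : ℍ → ℂ,
    (∀ τ : ℍ, HasSum
      (fun m : ℕ => PowerSeries.coeff m A *
        Complex.exp (2 * (Real.pi : ℂ) * Complex.I * (τ : ℂ)) ^ m) (f τ)) ∧
    IsQuasimodularForm 4 (chi4 ^ n) (n : ℤ) f

end QuasiTheta

end

/-! The explicit formula is a comparison of coefficients: only even powers of X occur in Ω, and
n!/((n-2k)! (2k+1)!) = C(n+1, 2k+1)/(n+1). The constant term follows because θ and every U_{2k} have
constant term 1 and the odd binomials of row n+1 sum to 2^n. Sums and products of quasimodular forms
are quasimodular and χ₋₄² = 1, so it remains to treat U_{2k} and θ².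

Write D = q d/dq and J = ∑ (-1)^k (2k+1) q^{k(k+1)/2}. Since (2k+1)² = 1 + 8·k(k+1)/2, inserting a
factor (2k+1)² is applying 1 + 8D; hence U_{m+2} = 8 D U_m + U_2 U_m (`ramanujanU_add_two`). To see
U_2 = E₂, view J as a derivative of Jacobi's theta function at a half period where theta itself
vanishes. Then q J⁸ is a cusp form of weight 12, so a multiple of Δ, and the logarithmic derivative
of Δ is E₂ (`cubicTheta_add_deriv`). Finally 8D + E₂ preserves the polynomials in E₂ with level-one
modular coefficients, raising the weight by 2 (`IsE2Polynomial.derivation`), and E₂ is quasimodular.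

For θ², translation and inversion give the transformation law under T, -1 and (1, 0; 4m, 1); a
Euclidean descent on the lower-left entry shows that these generate Γ₀(4)
(`Gamma0_four_le_thetaGroup`). Boundedness at the cusps comes from ‖θ²‖ ≤ C (1 + 1/Im τ) and
periodicity. -/

noncomputable section

namespace QuasiTheta

open Complex Derivative

/-! ### Convergent `q`-series on the upper half-plane -/

/-- The nome `q = e^{2πiτ}`. -/
abbrev nome (τ : ℍ) : ℂ := cexp (2 * (Real.pi : ℂ) * I * (τ : ℂ))

/-- The formal `q`-series `A` converges on the upper half-plane, with sum `f`. -/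
def HasQSeries (A : ℂ⟦X⟧) (f : ℍ → ℂ) : Prop :=
  ∀ τ : ℍ, HasSum (fun m : ℕ => PowerSeries.coeff m A * nome τ ^ m) (f τ)

lemma nome_ne_zero (τ : ℍ) : nome τ ≠ 0 := exp_ne_zero _

lemma qParam_one_eq_nome (τ : ℍ) : Function.Periodic.qParam 1 (τ : ℂ) = nome τ := by
  simp [Function.Periodic.qParam, nome]

lemma norm_nome_lt_one (τ : ℍ) : ‖nome τ‖ < 1 := by
  rw [← qParam_one_eq_nome]
  exact Function.Periodic.norm_qParam_lt_one one_pos τ.im_pos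

lemma exists_nome_eq {q : ℂ} (h0 : q ≠ 0) (h1 : ‖q‖ < 1) : ∃ τ : ℍ, nome τ = q := by
  refine ⟨⟨Function.Periodic.invQParam 1 q,
    Function.Periodic.im_invQParam_pos_of_norm_lt_one one_pos h1 h0⟩, ?_⟩
  rw [← qParam_one_eq_nome]
  exact Function.Periodic.qParam_right_inv one_ne_zero h0

lemma nome_mem_eball (τ : ℍ) : nome τ ∈ Metric.eball (0 : ℂ) 1 := by
  simpa [enorm_eq_nnnorm, ← NNReal.coe_lt_coe] using norm_nome_lt_one τ

namespace HasQSeries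

variable {A B : ℂ⟦X⟧} {f g : ℍ → ℂ}

lemma summable_norm (hA : HasQSeries A f) (τ : ℍ) :
    Summable fun m : ℕ => ‖PowerSeries.coeff m A * nome τ ^ m‖ :=
  (hA τ).summable.norm

lemma add (hA : HasQSeries A f) (hB : HasQSeries B g) : HasQSeries (A + B) (f + g) := fun τ => by
  simpa [add_mul] using (hA τ).add (hB τ)

lemma C_mul (hA : HasQSeries A f) (c : ℂ) : HasQSeries (PowerSeries.C c * A) (c • f) := fun τ => by
  simpa [mul_assoc] using (hA τ).mul_left c

lemma const (c : ℂ) : HasQSeries (PowerSeries.C c) (fun _ => c) := fun τ => by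
  convert hasSum_single (f := fun m : ℕ => PowerSeries.coeff m (PowerSeries.C c) * nome τ ^ m) 0 ?_
    using 1
  · simp
  · intro m hm
    simp [PowerSeries.coeff_C, hm]

lemma mul (hA : HasQSeries A f) (hB : HasQSeries B g) : HasQSeries (A * B) (f * g) := fun τ => by
  have hterm : (fun m : ℕ => PowerSeries.coeff m (A * B) * nome τ ^ m) = fun m =>
      ∑ kl ∈ Finset.HasAntidiagonal.antidiagonal m, (PowerSeries.coeff kl.1 A * nome τ ^ kl.1) *
        (PowerSeries.coeff kl.2 B * nome τ ^ kl.2) := by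
    funext m
    rw [PowerSeries.coeff_mul, Finset.sum_mul]
    refine Finset.sum_congr rfl fun kl hkl => ?_
    rw [← Finset.HasAntidiagonal.mem_antidiagonal.mp hkl, pow_add]
    ring
  have hs := (summable_norm_sum_mul_antidiagonal_of_summable_norm
    (hA.summable_norm τ) (hB.summable_norm τ)).of_norm
  have ht := tsum_mul_tsum_eq_tsum_sum_antidiagonal_of_summable_norm
    (hA.summable_norm τ) (hB.summable_norm τ)
  rw [(hA τ).tsum_eq, (hB τ).tsum_eq] at ht
  rw [hterm, Pi.mul_apply, ht]
  exact hs.hasSum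

lemma pow (hA : HasQSeries A f) (n : ℕ) : HasQSeries (A ^ n) (f ^ n) := by
  induction n with
  | zero => simpa using! const 1
  | succ n ih => simpa [pow_succ] using ih.mul hA

/-- A convergent `q`-series is a power series in the nome which converges on the unit disc. -/
lemma exists_hasFPowerSeriesOnBall (hA : HasQSeries A f) :
    ∃ F : ℂ → ℂ, HasFPowerSeriesOnBall F
      (FormalMultilinearSeries.ofScalars ℂ fun m => PowerSeries.coeff m A) 0 1 ∧
      ∀ τ, F (nome τ) = f τ := by
  set p := FormalMultilinearSeries.ofScalars ℂ fun m => PowerSeries.coeff m A with hp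
  have hr : (1 : ENNReal) ≤ p.radius := by
    -- Every real r in (0, 1) is itself a nome, and absolute convergence there bounds the radius
    -- below by r.
    refine le_of_forall_lt_imp_le_of_dense fun r hr => ?_
    rcases eq_or_ne r 0 with rfl | hr'
    · simp
    · lift r to NNReal using hr.ne_top
      obtain ⟨τ, hτ⟩ := exists_nome_eq (q := ((r : ℝ) : ℂ)) (by simpa using hr')
        (by simpa using hr)
      refine FormalMultilinearSeries.le_radius_of_summable _ ?_
      have h := hA.summable_norm τ
      rw [hτ] at h
      simpa [hp, FormalMultilinearSeries.ofScalars_norm] using h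
  have hF := (p.hasFPowerSeriesOnBall (one_pos.trans_le hr)).mono one_pos hr
  refine ⟨p.sum, hF, fun τ => ?_⟩
  have h := hF.hasSum (nome_mem_eball τ)
  rw [zero_add] at h
  refine h.unique ?_
  simpa [hp, FormalMultilinearSeries.ofScalars_apply_eq, mul_comm] using hA τ

/-- Identity principle: nomes fill the punctured unit disc and continuity adds the centre. It turns
identities on ℍ into identities of formal series. -/
lemma eq_of_eq (hA : HasQSeries A f) (hB : HasQSeries B f) : A = B := by
  obtain ⟨F, hF, hFf⟩ := hA.exists_hasFPowerSeriesOnBall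
  obtain ⟨G, hG, hGf⟩ := hB.exists_hasFPowerSeriesOnBall
  have hev : F =ᶠ[nhds 0] G := by
    refine (hF.hasFPowerSeriesAt.continuousAt.eventuallyEq_nhds_iff_eventuallyEq_nhdsNE
      hG.hasFPowerSeriesAt.continuousAt).mp ?_
    filter_upwards [self_mem_nhdsWithin, nhdsWithin_le_nhds (Metric.ball_mem_nhds 0 one_pos)]
      with q h0 h1
    obtain ⟨τ, rfl⟩ := exists_nome_eq h0 (by simpa using h1)
    rw [hFf, hGf]
  have h := (hF.hasFPowerSeriesAt.congr hev).eq_formalMultilinearSeries hG.hasFPowerSeriesAt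
  ext m
  simpa using congr_arg (FormalMultilinearSeries.coeff · m) h

lemma isBoundedAtImInfty (hA : HasQSeries A f) : UpperHalfPlane.IsBoundedAtImInfty f :=
  UpperHalfPlane.isBoundedAtImInfty_of_hasSum_qExpansion one_pos fun τ => by
    simpa only [qParam_one_eq_nome, smul_eq_mul] using hA τ

lemma tendsto_atImInfty (hA : HasQSeries A f) :
    Filter.Tendsto f UpperHalfPlane.atImInfty (nhds (PowerSeries.constantCoeff A)) := by
  obtain ⟨F, hF, hFf⟩ := hA.exists_hasFPowerSeriesOnBall
  have h0 : F 0 = PowerSeries.constantCoeff A := by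
    have := hF.hasFPowerSeriesAt.coeff_zero (fun _ => 0)
    simpa [FormalMultilinearSeries.ofScalars_apply_eq] using this.symm
  have hq : Filter.Tendsto nome UpperHalfPlane.atImInfty (nhds 0) := by
    have := UpperHalfPlane.qParam_tendsto_atImInfty one_pos
    simp only [qParam_one_eq_nome] at this
    exact this
  rw [← h0, show f = fun τ => F (nome τ) from funext fun τ => (hFf τ).symm]
  exact hF.hasFPowerSeriesAt.continuousAt.tendsto.comp hq

lemma apply_eq_of_nome_eq (hA : HasQSeries A f) {τ τ' : ℍ} (h : nome τ = nome τ') :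
    f τ = f τ' := by
  have := hA τ
  rw [h] at this
  exact this.unique (hA τ')

lemma hasDerivAt_comp_nome {F : ℂ → ℂ} {τ : ℍ} (hF : DifferentiableAt ℂ F (nome τ))
    (hFf : ∀ τ, F (nome τ) = f τ) :
    HasDerivAt (f ∘ UpperHalfPlane.ofComplex)
      (deriv F (nome τ) * (nome τ * (2 * (Real.pi : ℂ) * I))) τ := by
  have hq : HasDerivAt (fun z : ℂ => cexp (2 * (Real.pi : ℂ) * I * z))
      (nome τ * (2 * (Real.pi : ℂ) * I)) τ := by
    simpa using ((hasDerivAt_id (τ : ℂ)).const_mul (2 * (Real.pi : ℂ) * I)).cexp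
  refine (hF.hasDerivAt.comp (τ : ℂ) hq).congr_of_eventuallyEq ?_
  filter_upwards [UpperHalfPlane.isOpen_upperHalfPlaneSet.mem_nhds τ.im_pos] with z hz
  simp only [Function.comp_apply, ← hFf]
  rw [UpperHalfPlane.ofComplex_apply_of_im_pos hz]

lemma mdifferentiable (hA : HasQSeries A f) : MDifferentiable 𝓘(ℂ) 𝓘(ℂ) f := by
  obtain ⟨F, hF, hFf⟩ := hA.exists_hasFPowerSeriesOnBall
  intro τ
  rw [UpperHalfPlane.mdifferentiableAt_iff]
  exact (hasDerivAt_comp_nome (hF.analyticAt_of_mem (nome_mem_eball τ)).differentiableAt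
    hFf).differentiableAt

end HasQSeries

/-- The derivation `q d/dq` of formal `q`-series. -/
def qDeriv (A : ℂ⟦X⟧) : ℂ⟦X⟧ := PowerSeries.X * PowerSeries.derivative ℂ A

lemma coeff_qDeriv (A : ℂ⟦X⟧) (m : ℕ) :
    PowerSeries.coeff m (qDeriv A) = m * PowerSeries.coeff m A := by
  cases m with
  | zero => simp [qDeriv]
  | succ m =>
    rw [qDeriv, PowerSeries.coeff_succ_X_mul, PowerSeries.coeff_derivative]
    push_cast
    ring

lemma qDeriv_mul (A B : ℂ⟦X⟧) : qDeriv (A * B) = qDeriv A * B + A * qDeriv B := by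
  simp only [qDeriv, Derivation.leibniz, smul_eq_mul]
  ring

lemma HasQSeries.deriv {A : ℂ⟦X⟧} {f : ℍ → ℂ} (hA : HasQSeries A f) :
    HasQSeries (qDeriv A) (normalizedDerivOfComplex f) := fun τ => by
  obtain ⟨F, hF, hFf⟩ := hA.exists_hasFPowerSeriesOnBall
  have hd := (hasDerivAt_comp_nome
    (hF.analyticAt_of_mem (nome_mem_eball τ)).differentiableAt hFf).deriv
  have h := hF.fderiv.hasSum (nome_mem_eball τ)
  rw [zero_add] at h
  -- Applying the derivative at q to the vector q gives q F'(q), whose terms are (m+1) a_{m+1}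
  -- q^{m+1}; the vanishing term m = 0 accounts for the shift that follows.
  have h' := h.mapL (ContinuousLinearMap.apply ℂ ℂ (nome τ))
  rw [← hasSum_nat_add_iff' 1]
  convert h' using 1
  · funext m
    rw [ContinuousLinearMap.apply_apply, FormalMultilinearSeries.derivSeries_apply_diag,
      FormalMultilinearSeries.ofScalars_apply_eq, coeff_qDeriv]
    simp [mul_assoc]
  · rw [normalizedDerivOfComplex, hd]
    have : (2 * (Real.pi : ℂ) * I) ≠ 0 := by simp [Real.pi_ne_zero]
    simp only [Finset.range_one, Finset.sum_singleton, coeff_qDeriv, Nat.cast_zero, zero_mul,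
      sub_zero, ContinuousLinearMap.apply_apply, fderiv_eq_smul_deriv, smul_eq_mul]
    rw [mul_left_comm, mul_left_comm (nome τ), inv_mul_eq_div, mul_div_assoc]
    field_simp

/-! ### Ramanujan's series: formal recursion -/

lemma mul_succ_div_two_mul_two (k : ℕ) : k * (k + 1) / 2 * 2 = k * (k + 1) :=
  Nat.div_mul_cancel (Nat.even_mul_succ_self k).two_dvd

lemma triangular_injective : Function.Injective fun k : ℕ => k * (k + 1) / 2 := by
  intro a b h
  have h' : a * (a + 1) = b * (b + 1) := by
    rw [← mul_succ_div_two_mul_two a, ← mul_succ_div_two_mul_two b]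
    exact congrArg (· * 2) h
  nlinarith [lt_trichotomy a b]

lemma le_triangular (k : ℕ) : k ≤ k * (k + 1) / 2 := by
  rcases k with _ | k
  · simp
  · have := mul_succ_div_two_mul_two (k + 1)
    nlinarith

lemma coeff_oddPowerSum_triangular (s k : ℕ) :
    PowerSeries.coeff (k * (k + 1) / 2) (oddPowerSum s) = (-1) ^ k * (2 * (k : ℂ) + 1) ^ s := by
  rw [oddPowerSum, PowerSeries.coeff_mk, Finset.sum_eq_single k]
  · simp
  · intro j _ hj
    exact if_neg fun h => hj (triangular_injective h)
  · intro h
    exact absurd (Finset.mem_range.mpr (Nat.lt_succ_of_le (le_triangular k))) h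

lemma coeff_oddPowerSum_of_notMem_range (s m : ℕ)
    (hm : m ∉ Set.range fun k : ℕ => k * (k + 1) / 2) :
    PowerSeries.coeff m (oddPowerSum s) = 0 := by
  rw [oddPowerSum, PowerSeries.coeff_mk]
  exact Finset.sum_eq_zero fun k _ => if_neg fun h => hm ⟨k, h⟩

lemma constantCoeff_oddPowerSum (s : ℕ) : PowerSeries.constantCoeff (oddPowerSum s) = 1 := by
  simpa using coeff_oddPowerSum_triangular s 0

/-- (2k+1)² = 1 + 8·k(k+1)/2, and q d/dq multiplies the k-th term by k(k+1)/2. -/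
lemma oddPowerSum_add_two (s : ℕ) :
    oddPowerSum (s + 2) = oddPowerSum s + PowerSeries.C 8 * qDeriv (oddPowerSum s) := by
  ext m
  rw [map_add, PowerSeries.coeff_C_mul, coeff_qDeriv]
  by_cases hm : m ∈ Set.range fun k : ℕ => k * (k + 1) / 2
  · obtain ⟨k, rfl⟩ := hm
    simp only [coeff_oddPowerSum_triangular]
    have h : ((k * (k + 1) / 2 : ℕ) : ℂ) * 2 = k * (k + 1) := by
      exact_mod_cast mul_succ_div_two_mul_two k
    linear_combination (-(4 : ℂ)) * (-1) ^ k * (2 * (k : ℂ) + 1) ^ s * h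
  · simp [coeff_oddPowerSum_of_notMem_range _ m hm]

lemma ramanujanU_mul_oddPowerSum_one (m : ℕ) :
    ramanujanU m * oddPowerSum 1 = oddPowerSum (m + 1) := by
  rw [ramanujanU, mul_assoc, PowerSeries.inv_mul_cancel _ (by simp [constantCoeff_oddPowerSum]),
    mul_one]

lemma oddPowerSum_one_ne_zero : oddPowerSum 1 ≠ 0 := fun h => by
  simpa [h] using constantCoeff_oddPowerSum 1

lemma ramanujanU_eq_of_mul_eq {m : ℕ} {A : ℂ⟦X⟧} (h : A * oddPowerSum 1 = oddPowerSum (m + 1)) :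
    ramanujanU m = A :=
  mul_right_cancel₀ oddPowerSum_one_ne_zero ((ramanujanU_mul_oddPowerSum_one m).trans h.symm)

lemma ramanujanU_zero : ramanujanU 0 = 1 := ramanujanU_eq_of_mul_eq (one_mul _)

lemma constantCoeff_ramanujanU (m : ℕ) : PowerSeries.constantCoeff (ramanujanU m) = 1 := by
  simp [ramanujanU, constantCoeff_oddPowerSum]

/-- Apply 1 + 8D to U_m J = ∑ (-1)^k (2k+1)^{m+1} q^{k(k+1)/2} by the Leibniz rule, use U_2 J = J +
8DJ, and cancel J. -/
lemma ramanujanU_add_two (m : ℕ) :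
    ramanujanU (m + 2) =
      PowerSeries.C 8 * qDeriv (ramanujanU m) + ramanujanU 2 * ramanujanU m := by
  refine ramanujanU_eq_of_mul_eq ?_
  have h1 := ramanujanU_mul_oddPowerSum_one m
  have h2 := ramanujanU_mul_oddPowerSum_one 2
  have h3 := oddPowerSum_add_two 1
  have h4 := oddPowerSum_add_two (m + 1)
  have h5 := congrArg qDeriv h1
  rw [qDeriv_mul] at h5
  rw [show m + 2 + 1 = m + 1 + 2 by ring, h4, ← h5, ← h1]
  linear_combination ramanujanU m * h2 + ramanujanU m * h3

/-! ### Jacobi's identity for the cube of the Dedekind eta function -/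

/-- The sum `∑_{k ≥ 0} (-1)^k (2k+1) q^{k(k+1)/2}`, as a value of the derivative of Jacobi's
two-variable theta function. -/
def cubicTheta (τ : ℍ) : ℂ :=
  jacobiTheta₂' ((1 + (τ : ℂ)) / 2) τ / (2 * (Real.pi : ℂ) * I)

lemma jacobiTheta₂_term_half_period (n : ℤ) (τ : ℂ) :
    jacobiTheta₂_term n ((1 + τ) / 2) τ =
      (-1) ^ n * cexp ((Real.pi : ℂ) * I * (n * (n + 1) : ℤ) * τ) := by
  rw [jacobiTheta₂_term, ← exp_pi_mul_I, ← exp_int_mul, ← exp_add]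
  congr 1
  push_cast
  ring

lemma nome_pow_triangular (k : ℕ) (τ : ℍ) :
    nome τ ^ (k * (k + 1) / 2) = cexp ((Real.pi : ℂ) * I * (k * (k + 1)) * τ) := by
  rw [nome, ← exp_nat_mul]
  congr 1
  have h : ((k * (k + 1) / 2 : ℕ) : ℂ) * 2 = k * (k + 1) := by
    exact_mod_cast mul_succ_div_two_mul_two k
  linear_combination (Real.pi : ℂ) * I * τ * h

lemma jacobiTheta₂_term_natCast (k : ℕ) (τ : ℍ) :
    jacobiTheta₂_term k ((1 + (τ : ℂ)) / 2) τ = (-1) ^ k * nome τ ^ (k * (k + 1) / 2) := by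
  rw [jacobiTheta₂_term_half_period, nome_pow_triangular]
  push_cast
  rfl

lemma jacobiTheta₂_term_neg_succ (k : ℕ) (τ : ℍ) :
    jacobiTheta₂_term (-(k + 1 : ℤ)) ((1 + (τ : ℂ)) / 2) τ =
      -((-1) ^ k * nome τ ^ (k * (k + 1) / 2)) := by
  rw [jacobiTheta₂_term_half_period, nome_pow_triangular, zpow_neg, ← inv_zpow]
  norm_num
  rw [zpow_add₀ (by norm_num), zpow_one, zpow_natCast]
  ring_nf

/-- The terms n and -n-1 share the exponent n(n+1) and have opposite signs. In the derivative the
same pairing produces the factor n - (-n-1) = 2n+1. -/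
lemma jacobiTheta₂_half_period (τ : ℍ) : jacobiTheta₂ ((1 + (τ : ℂ)) / 2) τ = 0 := by
  refine (hasSum_jacobiTheta₂_term _ τ.im_pos).nat_add_neg_add_one.unique ?_
  simp only [jacobiTheta₂_term_natCast, jacobiTheta₂_term_neg_succ, add_neg_cancel]
  exact hasSum_zero

lemma hasQSeries_cubicTheta : HasQSeries (oddPowerSum 1) cubicTheta := fun τ => by
  have h := ((hasSum_jacobiTheta₂'_term ((1 + (τ : ℂ)) / 2)
    τ.im_pos).nat_add_neg_add_one).div_const (2 * (Real.pi : ℂ) * I)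
  rw [← Function.Injective.hasSum_iff triangular_injective
    fun m hm => by rw [coeff_oddPowerSum_of_notMem_range _ _ hm, zero_mul]]
  refine h.congr_fun ?_
  intro k
  have hpi : (Real.pi : ℂ) ≠ 0 := by simp [Real.pi_ne_zero]
  simp only [Function.comp_apply, coeff_oddPowerSum_triangular, jacobiTheta₂'_term]
  rw [jacobiTheta₂_term_natCast, jacobiTheta₂_term_neg_succ]
  push_cast
  field_simp
  ring

lemma jacobiTheta₂_one_sub (z τ : ℂ) : jacobiTheta₂ (1 - z) τ = jacobiTheta₂ z τ := by
  rw [sub_eq_neg_add, jacobiTheta₂_add_left, jacobiTheta₂_neg_left]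

lemma jacobiTheta₂'_one_sub (z τ : ℂ) : jacobiTheta₂' (1 - z) τ = -jacobiTheta₂' z τ := by
  rw [sub_eq_neg_add, jacobiTheta₂'_add_left, jacobiTheta₂'_neg_left]

lemma coe_S_smul (τ : ℍ) : ((ModularGroup.S • τ : ℍ) : ℂ) = -1 / τ := by
  rw [UpperHalfPlane.modular_S_smul]
  simp [neg_div]

/-- The functional equation of the derivative has an extra multiple of theta itself, which vanishes
here. The reflection z ↦ 1 - z returns to the half period of -1/τ and accounts for the sign. -/
lemma cubicTheta_eq (τ : ℍ) :
    cubicTheta τ = -(1 / (-I * (τ : ℂ)) ^ (1 / 2 : ℂ) *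
      cexp (-(Real.pi : ℂ) * I * ((1 + (τ : ℂ)) / 2) ^ 2 / τ) / τ *
        cubicTheta (ModularGroup.S • τ)) := by
  have hτ : (τ : ℂ) ≠ 0 := τ.ne_zero
  have hz : (1 + (τ : ℂ)) / 2 / τ = 1 - (1 + ((ModularGroup.S • τ : ℍ) : ℂ)) / 2 := by
    rw [coe_S_smul]
    field_simp
    ring
  rw [cubicTheta, jacobiTheta₂'_functional_equation, hz, ← coe_S_smul, jacobiTheta₂_one_sub,
    jacobiTheta₂'_one_sub, jacobiTheta₂_half_period, cubicTheta]
  ring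

/-- The product of the nome and the eighth power of `cubicTheta`: a multiple of `Δ`. -/
def cubicThetaPow : ℍ → ℂ := nome * cubicTheta ^ 8

lemma hasQSeries_nome : HasQSeries PowerSeries.X nome := fun τ => by
  convert hasSum_single (f := fun m : ℕ => PowerSeries.coeff m PowerSeries.X * nome τ ^ m) 1 ?_
    using 1
  · simp
  · intro m hm
    simp [PowerSeries.coeff_X, hm]

lemma hasQSeries_cubicThetaPow :
    HasQSeries (PowerSeries.X * oddPowerSum 1 ^ 8) cubicThetaPow :=
  hasQSeries_nome.mul (hasQSeries_cubicTheta.pow 8)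

lemma nome_T_smul (τ : ℍ) : nome (ModularGroup.T • τ) = nome τ := by
  rw [nome, UpperHalfPlane.modular_T_smul, UpperHalfPlane.coe_vadd, mul_add, exp_add]
  simp

lemma HasQSeries.slash_T {A : ℂ⟦X⟧} {f : ℍ → ℂ} (hA : HasQSeries A f) (k : ℤ) :
    f ∣[k] ModularGroup.T = f := by
  ext τ
  rw [ModularForm.SL_slash_apply, hA.apply_eq_of_nome_eq (nome_T_smul τ)]
  rw [ModularGroup.denom_apply]
  simp [ModularGroup.T]

/-- The eighth power removes the square root: τ⁴ from it and τ⁸ from 1/τ make weight 12, and the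
nome absorbs the Gaussian factor. -/
lemma cubicThetaPow_slash_S : cubicThetaPow ∣[(12 : ℤ)] ModularGroup.S = cubicThetaPow := by
  ext τ
  have hτ : (τ : ℂ) ≠ 0 := τ.ne_zero
  have hpow : ((-I * (τ : ℂ)) ^ (1 / 2 : ℂ)) ^ 8 = (τ : ℂ) ^ 4 := by
    rw [← cpow_nat_mul]
    norm_num
    rw [mul_pow, I_pow_four, one_mul]
  have hexp : cexp (-(Real.pi : ℂ) * I * ((1 + (τ : ℂ)) / 2) ^ 2 / τ) ^ 8 * nome τ =
      nome (ModularGroup.S • τ) := by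
    rw [nome, nome, ← exp_nat_mul, ← exp_add, coe_S_smul, exp_eq_exp_iff_exists_int]
    -- Expanding (1 + τ)² leaves the cross term -4πi.
    refine ⟨-2, ?_⟩
    push_cast
    field_simp
    ring
  rw [SlashInvariantForm.slash_S_apply, ← UpperHalfPlane.modular_S_smul]
  simp only [cubicThetaPow, Pi.mul_apply, Pi.pow_apply]
  rw [cubicTheta_eq τ, ← hexp]
  generalize cexp (-(Real.pi : ℂ) * I * ((1 + (τ : ℂ)) / 2) ^ 2 / τ) = E
  have hassoc (s c : ℂ) : (-(1 / s * E / τ * c)) ^ 8 = E ^ 8 * c ^ 8 / (s ^ 8 * (τ : ℂ) ^ 8) := by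
    ring
  rw [hassoc, hpow, show -(12 : ℤ) = -((12 : ℕ) : ℤ) by norm_num, zpow_neg, zpow_natCast]
  field_simp

lemma cubicThetaPow_slash (γ : SL(2, ℤ)) : cubicThetaPow ∣[(12 : ℤ)] γ = cubicThetaPow :=
  SlashInvariantForm.slash_action_generators_SL2Z cubicThetaPow_slash_S
    (hasQSeries_cubicThetaPow.slash_T 12) γ

/-- `cubicThetaPow` as a cusp form of weight 12 and level 1. -/
def cubicThetaPowCuspForm : CuspForm 𝒮ℒ 12 where
  toFun := cubicThetaPow
  slash_action_eq' A hA := by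
    obtain ⟨A, rfl⟩ := hA
    exact cubicThetaPow_slash A
  holo' := hasQSeries_cubicThetaPow.mdifferentiable
  zero_at_cusps' hc := by
    rw [Subgroup.IsArithmetic.isCusp_iff_isCusp_SL2Z] at hc
    rw [OnePoint.isZeroAt_iff_forall_SL2Z hc]
    intro γ _
    rw [cubicThetaPow_slash]
    simpa [UpperHalfPlane.IsZeroAtImInfty, Filter.ZeroAtFilter] using
      hasQSeries_cubicThetaPow.tendsto_atImInfty

/-- Cusp forms of weight 12 and level one form a line. The value of c is irrelevant, since only the
logarithmic derivative is used. -/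
lemma exists_cubicThetaPow_eq_smul_discriminant :
    ∃ c : ℂ, c ≠ 0 ∧ cubicThetaPow = c • ModularForm.discriminant := by
  obtain ⟨c, hc⟩ := CuspForm.exists_smul_discriminant_of_weight_eq_twelve cubicThetaPowCuspForm
  have hc' : cubicThetaPow = c • ModularForm.discriminant :=
    (congrArg (fun f : CuspForm 𝒮ℒ 12 => (f : ℍ → ℂ)) hc).symm
  refine ⟨c, ?_, hc'⟩
  rintro rfl
  have h0 : cubicTheta = fun _ => 0 := by
    funext τ
    simpa [cubicThetaPow] using congrFun hc' τ
  have h1 : oddPowerSum 1 = PowerSeries.C 0 := by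
    refine HasQSeries.eq_of_eq (f := cubicTheta) hasQSeries_cubicTheta ?_
    rw [h0]
    exact HasQSeries.const 0
  exact oddPowerSum_one_ne_zero (by simpa using h1)

lemma cubicTheta_ne_zero (τ : ℍ) : cubicTheta τ ≠ 0 := by
  obtain ⟨c, hc, h⟩ := exists_cubicThetaPow_eq_smul_discriminant
  have h1 : cubicThetaPow τ ≠ 0 := by
    rw [h]
    exact mul_ne_zero hc (ModularForm.discriminant_ne_zero τ)
  intro h2
  simp [cubicThetaPow, h2] at h1

/-- The logarithmic derivative of the discriminant is `E₂`. -/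
lemma normalizedDeriv_discriminant :
    normalizedDerivOfComplex ModularForm.discriminant =
      EisensteinSeries.E2 * ModularForm.discriminant := by
  ext τ
  have hη := ModularForm.eta_ne_zero τ.im_pos
  have hd := ModularForm.differentiableAt_eta_of_mem_upperHalfPlaneSet τ.im_pos
  have hlog := ModularForm.logDeriv_eta_eq_E2 τ
  rw [logDeriv_apply, div_eq_iff hη] at hlog
  have hder : HasDerivAt (ModularForm.discriminant ∘ UpperHalfPlane.ofComplex)
      (24 * ModularForm.eta τ ^ 23 * deriv ModularForm.eta τ) τ := by
    refine (hd.hasDerivAt.pow 24).congr_of_eventuallyEq ?_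
    filter_upwards [UpperHalfPlane.isOpen_upperHalfPlaneSet.mem_nhds τ.im_pos] with z hz
    simp [ModularForm.discriminant, UpperHalfPlane.ofComplex_apply_of_im_pos hz]
  have hpi : (Real.pi : ℂ) ≠ 0 := by simp [Real.pi_ne_zero]
  rw [normalizedDerivOfComplex, hder.deriv, hlog, Pi.mul_apply, ModularForm.discriminant]
  field_simp
  ring

lemma normalizedDeriv_nome : normalizedDerivOfComplex nome = nome := by
  have h : qDeriv (PowerSeries.X : ℂ⟦X⟧) = PowerSeries.X := by simp [qDeriv]
  funext τ
  exact (hasQSeries_nome.deriv τ).unique (by rw [h]; exact hasQSeries_nome τ)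

lemma cubicTheta_add_deriv :
    cubicTheta + (8 : ℂ) • normalizedDerivOfComplex cubicTheta =
      EisensteinSeries.E2 * cubicTheta := by
  obtain ⟨c, -, h⟩ := exists_cubicThetaPow_eq_smul_discriminant
  have hm := hasQSeries_cubicTheta.mdifferentiable
  have hΔ : MDifferentiable 𝓘(ℂ) 𝓘(ℂ) ModularForm.discriminant := CuspForm.discriminant.holo'
  have h1 : normalizedDerivOfComplex cubicThetaPow = EisensteinSeries.E2 * cubicThetaPow := by
    rw [h, normalizedDerivOfComplex_smul _ _ hΔ, normalizedDeriv_discriminant, mul_smul_comm]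
  rw [cubicThetaPow, normalizedDerivOfComplex_mul _ _ hasQSeries_nome.mdifferentiable
    (hasQSeries_cubicTheta.pow 8).mdifferentiable, normalizedDeriv_nome,
    normalizedDerivOfComplex_pow _ _ hm] at h1
  funext τ
  have h2 := congrFun h1 τ
  have h3 := cubicTheta_ne_zero τ
  have h4 := nome_ne_zero τ
  simp only [Pi.add_apply, Pi.mul_apply, Pi.pow_apply, Pi.smul_apply, smul_eq_mul,
    Pi.natCast_apply] at h2 ⊢
  -- D(q J⁸) = E₂ q J⁸ reads q J⁷ (J + 8 DJ) = q J⁷ E₂ J; the common factor cancels because Δ has no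
  -- zeros.
  have h5 : nome τ * cubicTheta τ ^ 7 ≠ 0 := mul_ne_zero h4 (pow_ne_zero _ h3)
  refine mul_left_cancel₀ h5 ?_
  push_cast at h2
  linear_combination h2

/-- The `q`-series of `E₂`. -/
def E2Series : ℂ⟦X⟧ :=
  PowerSeries.mk fun m => if m = 0 then 1 else -24 * (ArithmeticFunction.sigma 1 m : ℂ)

lemma hasQSeries_E2Series : HasQSeries E2Series EisensteinSeries.E2 := fun τ => by
  simpa [E2Series, nome] using EisensteinSeries.hasSum_qExpansion_E2 (z := τ)

/-- Ramanujan's series `U_2` is the Eisenstein series `E₂`. -/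
lemma hasQSeries_ramanujanU_two : HasQSeries (ramanujanU 2) EisensteinSeries.E2 := by
  have h : ramanujanU 2 = E2Series := by
    refine ramanujanU_eq_of_mul_eq ?_
    refine (hasQSeries_E2Series.mul hasQSeries_cubicTheta).eq_of_eq ?_
    rw [← cubicTheta_add_deriv, oddPowerSum_add_two]
    exact hasQSeries_cubicTheta.add (hasQSeries_cubicTheta.deriv.C_mul 8)
  rw [h]
  exact hasQSeries_E2Series

/-! ### Closure properties of quasimodular forms -/

/-- The function `τ ↦ 1 / Im τ`. -/
def imInv : ℍ → ℂ := fun τ => ((τ.im : ℝ) : ℂ)⁻¹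

/-- Quasimodularity, with the almost holomorphic form written as a polynomial in `1 / Im τ`. -/
lemma isQuasimodularForm_iff {N : ℕ} {χ : DirichletCharacter ℂ N} {k : ℤ} {f : ℍ → ℂ} :
    IsQuasimodularForm N χ k f ↔ ∃ G : Polynomial (ℍ → ℂ), G.coeff 0 = f ∧
      (∀ r, MDifferentiable 𝓘(ℂ) 𝓘(ℂ) (G.coeff r)) ∧
      (∀ γ ∈ CongruenceSubgroup.Gamma0 N,
        G.eval imInv ∣[k] γ = χ ((γ 1 1 : ℤ) : ZMod N) • G.eval imInv) ∧
      ∀ γ : SL(2, ℤ), UpperHalfPlane.IsBoundedAtImInfty (G.eval imInv ∣[k] γ) := by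
  constructor
  · rintro ⟨p, g, F, h0, hg, hF, hslash, hbdd⟩
    have hcoeff (r : ℕ) : (∑ s ∈ Finset.range (p + 1),
        Polynomial.C (g s) * Polynomial.X ^ s).coeff r = if r < p + 1 then g r else 0 := by
      simp [Polynomial.finsetSum_coeff, Polynomial.coeff_C_mul, Polynomial.coeff_X_pow]
    have heval : (∑ s ∈ Finset.range (p + 1),
        Polynomial.C (g s) * Polynomial.X ^ s).eval imInv = F := by
      funext τ
      simp [Polynomial.eval_finsetSum, hF, imInv, div_eq_mul_inv]
    refine ⟨∑ s ∈ Finset.range (p + 1), Polynomial.C (g s) * Polynomial.X ^ s, ?_, ?_, ?_, ?_⟩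
    · simp [hcoeff, h0]
    · intro r
      rw [hcoeff]
      split_ifs
      · exact hg r
      · exact mdifferentiable_const
    · rwa [heval]
    · rwa [heval]
  · rintro ⟨G, h0, hG, hslash, hbdd⟩
    refine ⟨G.natDegree, G.coeff, G.eval imInv, h0, hG, fun τ => ?_, hslash, hbdd⟩
    rw [Polynomial.eval_eq_sum_range]
    simp [imInv, div_eq_mul_inv]

namespace IsQuasimodularForm

variable {N : ℕ} {χ ψ : DirichletCharacter ℂ N} {k l : ℤ} {f g : ℍ → ℂ}

lemma add (hf : IsQuasimodularForm N χ k f) (hg : IsQuasimodularForm N χ k g) :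
    IsQuasimodularForm N χ k (f + g) := by
  rw [isQuasimodularForm_iff] at *
  obtain ⟨G, rfl, hG, hGs, hGb⟩ := hf
  obtain ⟨H, rfl, hH, hHs, hHb⟩ := hg
  refine ⟨G + H, Polynomial.coeff_add .., fun r => ?_, fun γ hγ => ?_, fun γ => ?_⟩
  · rw [Polynomial.coeff_add]
    exact (hG r).add (hH r)
  · rw [Polynomial.eval_add, SlashAction.add_slash, hGs γ hγ, hHs γ hγ, smul_add]
  · rw [Polynomial.eval_add, SlashAction.add_slash]
    exact (hGb γ).add (hHb γ)

lemma mdifferentiable_sum {ι : Type*} (s : Finset ι) (u : ι → ℍ → ℂ)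
    (hu : ∀ i, MDifferentiable 𝓘(ℂ) 𝓘(ℂ) (u i)) :
    MDifferentiable 𝓘(ℂ) 𝓘(ℂ) (∑ i ∈ s, u i) := by
  classical
  induction s using Finset.induction_on with
  | empty => exact mdifferentiable_const
  | insert i s hi ih =>
    rw [Finset.sum_insert hi]
    exact (hu i).add ih

lemma mul (hf : IsQuasimodularForm N χ k f) (hg : IsQuasimodularForm N ψ l g) :
    IsQuasimodularForm N (χ * ψ) (k + l) (f * g) := by
  rw [isQuasimodularForm_iff] at *
  obtain ⟨G, rfl, hG, hGs, hGb⟩ := hf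
  obtain ⟨H, rfl, hH, hHs, hHb⟩ := hg
  refine ⟨G * H, Polynomial.mul_coeff_zero .., fun r => ?_, fun γ hγ => ?_, fun γ => ?_⟩
  · rw [Polynomial.coeff_mul]
    exact mdifferentiable_sum _ _ fun i => (hG i.1).mul (hH i.2)
  · rw [Polynomial.eval_mul, ModularForm.mul_slash_SL2, hGs γ hγ, hHs γ hγ, MulChar.mul_apply,
      smul_mul_smul_comm]
  · rw [Polynomial.eval_mul, ModularForm.mul_slash_SL2]
    exact (hGb γ).mul (hHb γ)

lemma pow (hf : IsQuasimodularForm N χ k f) (h1 : IsQuasimodularForm N 1 0 1) (n : ℕ) :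
    IsQuasimodularForm N (χ ^ n) (n * k) (f ^ n) := by
  induction n with
  | zero => simpa using h1
  | succ n ih => simpa [pow_succ, add_mul] using ih.mul hf

lemma sum {ι : Type*} {s : Finset ι} {u : ι → ℍ → ℂ} (h0 : IsQuasimodularForm N χ k 0)
    (hu : ∀ i ∈ s, IsQuasimodularForm N χ k (u i)) : IsQuasimodularForm N χ k (∑ i ∈ s, u i) := by
  classical
  induction s using Finset.induction_on with
  | empty => simpa using h0
  | insert i s hi ih =>
    rw [Finset.sum_insert hi]
    exact (hu i (Finset.mem_insert_self ..)).add
      (ih fun j hj => hu j (Finset.mem_insert_of_mem hj))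

end IsQuasimodularForm

/-- A holomorphic modular form is quasimodular. -/
lemma isQuasimodularForm_of_slash {N : ℕ} {χ : DirichletCharacter ℂ N} {k : ℤ} {f : ℍ → ℂ}
    (hf : MDifferentiable 𝓘(ℂ) 𝓘(ℂ) f)
    (hs : ∀ γ ∈ CongruenceSubgroup.Gamma0 N, f ∣[k] γ = χ ((γ 1 1 : ℤ) : ZMod N) • f)
    (hb : ∀ γ : SL(2, ℤ), UpperHalfPlane.IsBoundedAtImInfty (f ∣[k] γ)) :
    IsQuasimodularForm N χ k f := by
  refine isQuasimodularForm_iff.mpr ⟨Polynomial.C f, Polynomial.coeff_C_zero, fun r => ?_, ?_, ?_⟩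
  · rw [Polynomial.coeff_C]
    split_ifs
    · exact hf
    · exact mdifferentiable_const
  · simpa using hs
  · simpa using hb

/-- The trivial character is 1 only on units; ad ≡ 1 mod N makes d a unit. -/
lemma one_apply_of_mem_Gamma0 {N : ℕ} {γ : SL(2, ℤ)} (hγ : γ ∈ CongruenceSubgroup.Gamma0 N) :
    (1 : DirichletCharacter ℂ N) ((γ 1 1 : ℤ) : ZMod N) = 1 := by
  refine MulChar.one_apply (IsUnit.of_mul_eq_one ((γ 0 0 : ℤ) : ZMod N) ?_)
  have hdet := γ.det_coe
  rw [Matrix.det_fin_two] at hdet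
  have h := congrArg (Int.cast : ℤ → ZMod N) hdet
  rw [CongruenceSubgroup.Gamma0_mem] at hγ
  push_cast at h
  rw [hγ] at h
  linear_combination h

lemma isQuasimodularForm_of_levelOne (N : ℕ) {k : ℤ} {f : ℍ → ℂ} {A : ℂ⟦X⟧}
    (hA : HasQSeries A f) (hs : ∀ γ : SL(2, ℤ), f ∣[k] γ = f) :
    IsQuasimodularForm N 1 k f :=
  isQuasimodularForm_of_slash hA.mdifferentiable
    (fun γ hγ => by rw [hs, one_apply_of_mem_Gamma0 hγ, one_smul])
    (fun γ => by rw [hs]; exact hA.isBoundedAtImInfty)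

lemma isQuasimodularForm_const (N : ℕ) (c : ℂ) : IsQuasimodularForm N 1 0 (fun _ => c) :=
  isQuasimodularForm_of_levelOne N (HasQSeries.const c)
    fun γ => ModularForm.is_invariant_const γ c

lemma E2_slash_apply (γ : SL(2, ℤ)) (τ : ℍ) :
    (EisensteinSeries.E2 ∣[(2 : ℤ)] γ) τ =
      EisensteinSeries.E2 τ - 6 * I / Real.pi * ((γ 1 0 : ℂ) / UpperHalfPlane.denom γ τ) := by
  have hpi : (Real.pi : ℂ) ≠ 0 := by simp [Real.pi_ne_zero]
  rw [EisensteinSeries.E2_slash_action]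
  simp only [Pi.sub_apply, Pi.smul_apply, smul_eq_mul, EisensteinSeries.D2, riemannZeta_two]
  field_simp

lemma imInv_slash_apply (γ : SL(2, ℤ)) (τ : ℍ) :
    (imInv ∣[(2 : ℤ)] γ) τ =
      imInv τ - 2 * I * ((γ 1 0 : ℂ) / UpperHalfPlane.denom γ τ) := by
  have hd := UpperHalfPlane.denom_ne_zero γ τ
  have hy : ((τ.im : ℝ) : ℂ) ≠ 0 := by exact_mod_cast τ.im_ne_zero
  have him : (((γ • τ : ℍ).im : ℝ) : ℂ) =
      τ.im / (UpperHalfPlane.denom γ τ * (starRingEnd ℂ) (UpperHalfPlane.denom γ τ)) := by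
    rw [ModularGroup.im_smul_eq_div_normSq, Complex.mul_conj]
    push_cast
    rfl
  have hc : (starRingEnd ℂ) (UpperHalfPlane.denom γ τ) =
      UpperHalfPlane.denom γ τ - 2 * I * γ 1 0 * τ.im := by
    rw [ModularGroup.denom_apply]
    apply Complex.ext
    · simp
    · simp
      ring
  rw [ModularForm.SL_slash_apply, imInv, imInv, him, hc]
  rw [zpow_neg, zpow_ofNat]
  field_simp [hd, hy]

lemma isBoundedAtImInfty_imInv : UpperHalfPlane.IsBoundedAtImInfty imInv := by
  rw [UpperHalfPlane.isBoundedAtImInfty_iff]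
  refine ⟨1, 1, fun τ hτ => ?_⟩
  rw [imInv, norm_inv, norm_real, Real.norm_of_nonneg τ.im_pos.le]
  exact inv_le_one_of_one_le₀ hτ

lemma isQuasimodularForm_E2 (N : ℕ) : IsQuasimodularForm N 1 2 EisensteinSeries.E2 := by
  -- The constant -3/π makes the cocycles of E₂ and 1/Im τ, namely -6i/π and -2i times c/(cτ+d),
  -- cancel.
  set G : Polynomial (ℍ → ℂ) := Polynomial.C EisensteinSeries.E2 +
    Polynomial.C (fun _ => -3 / (Real.pi : ℂ)) * Polynomial.X with hG
  have heval : G.eval imInv = EisensteinSeries.E2 + (-3 / (Real.pi : ℂ)) • imInv := by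
    funext τ
    simp [hG]
  have hs (γ : SL(2, ℤ)) : G.eval imInv ∣[(2 : ℤ)] γ = G.eval imInv := by
    funext τ
    rw [heval, SlashAction.add_slash, ModularForm.SL_smul_slash]
    simp only [Pi.add_apply, Pi.smul_apply, smul_eq_mul, E2_slash_apply, imInv_slash_apply]
    ring
  refine isQuasimodularForm_iff.mpr ⟨G, by simp [hG], fun r => ?_, fun γ hγ => ?_, fun γ => ?_⟩
  · rw [hG, Polynomial.coeff_add, Polynomial.coeff_C_mul, Polynomial.coeff_C, Polynomial.coeff_X]
    refine MDifferentiable.add ?_ (mdifferentiable_const.mul ?_)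
    · split_ifs
      · exact hasQSeries_E2Series.mdifferentiable
      · exact mdifferentiable_const
    · split_ifs <;> exact mdifferentiable_const
  · rw [hs, one_apply_of_mem_Gamma0 hγ, one_smul]
  · rw [hs, heval]
    exact hasQSeries_E2Series.isBoundedAtImInfty.add
      (Filter.BoundedAtFilter.smul _ isBoundedAtImInfty_imInv)

/-! ### Polynomials in `E₂` with modular coefficients -/

/-- Sums of products `E₂^r g` with `g` modular of level one, homogeneous of weight `k`. -/
inductive IsE2Polynomial (k : ℕ) : (ℍ → ℂ) → Prop
  | monomial (r w : ℕ) (h : 2 * r + w = k) {A : ℂ⟦X⟧} {g : ℍ → ℂ} (hA : HasQSeries A g)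
      (hg : ∀ γ : SL(2, ℤ), g ∣[(w : ℤ)] γ = g) : IsE2Polynomial k (EisensteinSeries.E2 ^ r * g)
  | add {f g : ℍ → ℂ} (hf : IsE2Polynomial k f) (hg : IsE2Polynomial k g) :
      IsE2Polynomial k (f + g)

namespace IsE2Polynomial

lemma isQuasimodularForm {k : ℕ} {f : ℍ → ℂ} (hf : IsE2Polynomial k f) (N : ℕ) :
    IsQuasimodularForm N 1 k f := by
  induction hf with
  | monomial r w h hA hg =>
    have h1 := ((isQuasimodularForm_E2 N).pow (isQuasimodularForm_const N 1) r).mul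
      (isQuasimodularForm_of_levelOne N hA hg)
    have hk : (r : ℤ) * 2 + w = k := by omega
    simpa [hk] using h1
  | add _ _ hf hg => exact hf.add hg

lemma hasQSeries {k : ℕ} {f : ℍ → ℂ} (hf : IsE2Polynomial k f) : ∃ A, HasQSeries A f := by
  induction hf with
  | monomial r w h hA hg => exact ⟨_, (hasQSeries_E2Series.pow r).mul hA⟩
  | add _ _ hf hg =>
    obtain ⟨A, hA⟩ := hf
    obtain ⟨B, hB⟩ := hg
    exact ⟨_, hA.add hB⟩

end IsE2Polynomial

/-- Differentiate the law of E₂ and correct by the multiple of c/(cτ+d) by which D fails to commute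
with the slash action. -/
lemma deriv_E2_slash_apply (γ : SL(2, ℤ)) (τ : ℍ) :
    (normalizedDerivOfComplex EisensteinSeries.E2 ∣[(4 : ℤ)] γ) τ =
      normalizedDerivOfComplex EisensteinSeries.E2 τ
        - I / Real.pi * ((γ 1 0 : ℂ) / UpperHalfPlane.denom γ τ) * EisensteinSeries.E2 τ
        - 3 / Real.pi ^ 2 * ((γ 1 0 : ℂ) / UpperHalfPlane.denom γ τ) ^ 2 := by
  have hm := hasQSeries_E2Series.mdifferentiable
  have hpi : (Real.pi : ℂ) ≠ 0 := by simp [Real.pi_ne_zero]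
  have hd := UpperHalfPlane.denom_ne_zero γ τ
  have h1 := congrFun (normalizedDerivOfComplex_SL_slash (k := 2) hm (γ := γ)) τ
  have h2 : HasDerivAt ((EisensteinSeries.E2 ∣[(2 : ℤ)] γ) ∘ UpperHalfPlane.ofComplex)
      (deriv (EisensteinSeries.E2 ∘ UpperHalfPlane.ofComplex) τ -
        6 * I / Real.pi * γ 1 0 * (-(γ 1 0 : ℂ) * UpperHalfPlane.denom γ τ ^ (-2 : ℤ))) τ := by
    have hE := (UpperHalfPlane.mdifferentiableAt_iff.mp (hm τ)).hasDerivAt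
    have hden := UpperHalfPlane.hasDerivAt_denom_zpow (γ : GL (Fin 2) ℝ) (-1) τ
    refine (hE.sub ((hden.const_mul (6 * I / Real.pi * γ 1 0)).congr_deriv
      ?_)).congr_of_eventuallyEq ?_
    · simp
    · filter_upwards [UpperHalfPlane.isOpen_upperHalfPlaneSet.mem_nhds τ.im_pos] with z hz
      rw [Function.comp_apply, E2_slash_apply]
      simp [UpperHalfPlane.ofComplex_apply_of_im_pos hz]
      ring
  rw [normalizedDerivOfComplex, h2.deriv, Pi.sub_apply, E2_slash_apply] at h1
  have h3 : (normalizedDerivOfComplex EisensteinSeries.E2 ∣[(2 + 2 : ℤ)] γ) τ =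
    (normalizedDerivOfComplex EisensteinSeries.E2 ∣[(4 : ℤ)] γ) τ := rfl
  rw [h3] at h1
  have hinv : (2 * (Real.pi : ℂ) * I)⁻¹ = -I / (2 * Real.pi) := by
    rw [inv_eq_iff_eq_inv, eq_comm, inv_eq_iff_eq_inv, eq_comm]
    field_simp
    rw [I_sq]
    ring
  have hz : UpperHalfPlane.denom γ τ ^ (-2 : ℤ) = (UpperHalfPlane.denom γ τ)⁻¹ ^ 2 := by
    rw [zpow_neg, zpow_ofNat, inv_pow]
  rw [hinv, hz] at h1
  rw [normalizedDerivOfComplex, hinv]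
  simp only [div_eq_mul_inv] at h1 ⊢
  push_cast at h1
  generalize (UpperHalfPlane.denom γ τ)⁻¹ = v at h1 ⊢
  have hp : (2 * (Real.pi : ℂ))⁻¹ = (Real.pi : ℂ)⁻¹ / 2 := by
    rw [mul_inv]
    ring
  rw [hp] at h1 ⊢
  linear_combination -h1 + 3 * (Real.pi : ℂ)⁻¹ ^ 2 * (γ 1 0 : ℂ) ^ 2 * v ^ 2 * I_sq

/-- The modular form `E₂² - 12 q dE₂/dq` of weight four. -/
def weightFourForm : ℍ → ℂ :=
  EisensteinSeries.E2 ^ 2 + (-12 : ℂ) • normalizedDerivOfComplex EisensteinSeries.E2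

lemma hasQSeries_weightFourForm :
    HasQSeries (E2Series ^ 2 + PowerSeries.C (-12) * qDeriv E2Series) weightFourForm :=
  (hasQSeries_E2Series.pow 2).add (hasQSeries_E2Series.deriv.C_mul _)

lemma weightFourForm_slash (γ : SL(2, ℤ)) : weightFourForm ∣[(4 : ℤ)] γ = weightFourForm := by
  funext τ
  have h := congrFun (ModularForm.mul_slash_SL2 2 2 γ EisensteinSeries.E2 EisensteinSeries.E2) τ
  rw [show (2 + 2 : ℤ) = 4 by norm_num, ← pow_two, Pi.mul_apply, E2_slash_apply] at h
  rw [weightFourForm, SlashAction.add_slash, ModularForm.SL_smul_slash, Pi.add_apply,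
    Pi.smul_apply, deriv_E2_slash_apply, h]
  simp only [Pi.add_apply, Pi.smul_apply, Pi.pow_apply, smul_eq_mul, div_eq_mul_inv]
  linear_combination 36 * (Real.pi : ℂ)⁻¹ ^ 2 * (γ 1 0 : ℂ) ^ 2 *
    (UpperHalfPlane.denom γ τ)⁻¹ ^ 2 * I_sq

lemma serreDerivative_eq_add (k : ℂ) (g : ℍ → ℂ) :
    serreDerivative k g =
      normalizedDerivOfComplex g + (-(k / 12)) • (EisensteinSeries.E2 * g) := by
  funext τ
  simp only [serreDerivative_apply, Pi.add_apply, Pi.smul_apply, Pi.mul_apply, smul_eq_mul]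
  ring

lemma HasQSeries.serreDerivative {A : ℂ⟦X⟧} {g : ℍ → ℂ} (hA : HasQSeries A g) (k : ℂ) :
    HasQSeries (qDeriv A + PowerSeries.C (-(k / 12)) * (E2Series * A))
      (Derivative.serreDerivative k g) := by
  rw [serreDerivative_eq_add]
  exact hA.deriv.add ((hasQSeries_E2Series.mul hA).C_mul _)

lemma IsE2Polynomial.smul_monomial {k : ℕ} (c : ℂ) (r w : ℕ) (h : 2 * r + w = k) {A : ℂ⟦X⟧}
    {g : ℍ → ℂ} (hA : HasQSeries A g) (hg : ∀ γ : SL(2, ℤ), g ∣[(w : ℤ)] γ = g) :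
    IsE2Polynomial k (c • (EisensteinSeries.E2 ^ r * g)) := by
  rw [← mul_smul_comm]
  exact .monomial r w h (hA.C_mul c) fun γ => by rw [ModularForm.SL_smul_slash, hg]

/-- Substitute DE₂ = (E₂² - W)/12, with W = `weightFourForm`, and Dg = (Serre derivative of g) +
(w/12) E₂ g into the Leibniz rule for E₂^r g; each resulting term is again a monomial. -/
lemma IsE2Polynomial.derivation {k : ℕ} {f : ℍ → ℂ} (hf : IsE2Polynomial k f) :
    IsE2Polynomial (k + 2)
      ((8 : ℂ) • normalizedDerivOfComplex f + EisensteinSeries.E2 * f) := by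
  induction hf with
  | add hf hg ihf ihg =>
    obtain ⟨A, hA⟩ := hf.hasQSeries
    obtain ⟨B, hB⟩ := hg.hasQSeries
    rw [normalizedDerivOfComplex_add _ _ hA.mdifferentiable hB.mdifferentiable, smul_add, mul_add,
      add_add_add_comm]
    exact ihf.add ihg
  | @monomial r w h A g hA hg =>
    have hE := hasQSeries_E2Series.mdifferentiable
    have hserre := IsE2Polynomial.smul_monomial (k := k + 2) 8 r (w + 2) (by omega)
      (hA.serreDerivative w) fun γ => by
        have := serreDerivative_slash_invariant hA.mdifferentiable (hg γ)
        exact_mod_cast this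
    have htop := IsE2Polynomial.smul_monomial (k := k + 2) (8 * r / 12 + 8 * w / 12 + 1)
      (r + 1) w (by omega) hA hg
    rw [normalizedDerivOfComplex_mul _ _ (hasQSeries_E2Series.pow r).mdifferentiable
      hA.mdifferentiable, normalizedDerivOfComplex_pow _ _ hE]
    -- The term in E₂^{r-1} is present only for r > 0.
    rcases r with _ | r
    · convert htop.add hserre using 1
      funext τ
      simp
      ring
    · have hfour := IsE2Polynomial.smul_monomial (k := k + 2) (-(8 * (r + 1) / 12)) r (4 + w)
        (by omega) (hasQSeries_weightFourForm.mul hA) fun γ => by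
          push_cast
          rw [ModularForm.mul_slash_SL2, weightFourForm_slash, hg]
      convert (htop.add hserre).add hfour using 1
      funext τ
      simp [weightFourForm]
      ring

/-- Ramanujan's series `U_{2m}` is a quasimodular form of weight `2m` and level one. -/
lemma exists_hasQSeries_ramanujanU (m : ℕ) :
    ∃ f, HasQSeries (ramanujanU (2 * m)) f ∧ IsE2Polynomial (2 * m) f := by
  induction m with
  | zero =>
    refine ⟨fun _ => 1, by simpa [ramanujanU_zero] using HasQSeries.const 1, ?_⟩
    convert IsE2Polynomial.monomial (k := 2 * 0) 0 0 rfl (HasQSeries.const 1)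
      (fun γ => ModularForm.is_invariant_const γ 1) using 1
    funext τ
    simp
  | succ m ih =>
    obtain ⟨f, hf, hP⟩ := ih
    refine ⟨_, ?_, hP.derivation⟩
    rw [show 2 * (m + 1) = 2 * m + 2 by ring, ramanujanU_add_two]
    exact (hf.deriv.C_mul 8).add (hasQSeries_ramanujanU_two.mul hf)

/-! ### The theta series -/

/-- The sum of the theta series, `θ(q) = ∑_{n ∈ ℤ} q^{n²}`. -/
def thetaFun (τ : ℍ) : ℂ := jacobiTheta (2 * τ)

lemma two_mul_im_pos (τ : ℍ) : 0 < (2 * (τ : ℂ)).im := by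
  simpa using τ.im_pos

lemma succ_sq_injective : Function.Injective fun n : ℕ => (n + 1) ^ 2 := fun a b h => by
  simpa using h

lemma hasQSeries_theta : HasQSeries theta thetaFun := fun τ => by
  have h := (hasSum_nat_jacobiTheta (two_mul_im_pos τ)).mul_left 2
  have h2 : HasSum (fun m : ℕ => (if m = 0 then 0 else if IsSquare m then (2 : ℂ) else 0) *
      nome τ ^ m) (2 * ((jacobiTheta (2 * τ) - 1) / 2)) := by
    rw [← Function.Injective.hasSum_iff succ_sq_injective]
    · refine h.congr_fun fun n => ?_
      have hsq : IsSquare ((n + 1) ^ 2) := ⟨n + 1, pow_two _⟩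
      simp only [Function.comp_apply, if_pos hsq, if_neg (pow_ne_zero 2 n.succ_ne_zero)]
      rw [nome, ← exp_nat_mul]
      congr 2
      push_cast
      ring
    · intro m hm
      rcases eq_or_ne m 0 with rfl | h0
      · simp
      · have hsq : ¬ IsSquare m := by
          rintro ⟨r, rfl⟩
          refine hm ⟨r - 1, ?_⟩
          have hr : r ≠ 0 := fun h => h0 (by simp [h])
          simp only [Nat.sub_one_add_one hr, pow_two]
        simp [h0, hsq]
  convert (HasQSeries.const 1 τ).add h2 using 1
  · funext m
    rw [theta, PowerSeries.coeff_mk, PowerSeries.coeff_C]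
    split_ifs <;> ring
  · rw [thetaFun]
    ring

/-- The square of the theta series. -/
def thetaSq : ℍ → ℂ := thetaFun ^ 2

lemma hasQSeries_thetaSq : HasQSeries (theta ^ 2) thetaSq := hasQSeries_theta.pow 2

lemma jacobiTheta_int_mul_two_add (m : ℤ) (τ : ℂ) : jacobiTheta (m * 2 + τ) = jacobiTheta τ := by
  have h : Function.Periodic jacobiTheta 2 := fun z => by rw [add_comm, jacobiTheta_two_add]
  rw [add_comm]
  exact h.int_mul m τ

lemma jacobiTheta_neg_inv_sq {w : ℂ} (hw : 0 < w.im) :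
    jacobiTheta (-1 / w) ^ 2 = -I * w * jacobiTheta w ^ 2 := by
  have h := jacobiTheta_S_smul ⟨w, hw⟩
  rw [coe_S_smul] at h
  change jacobiTheta (-1 / w) = (-I * w) ^ (1 / 2 : ℂ) * jacobiTheta w at h
  rw [h, mul_pow, ← cpow_nat_mul]
  norm_num

/-! ### The theta multiplier system -/

lemma chi4_sq : chi4 ^ 2 = 1 := by
  rw [chi4, MulChar.ringHomComp_pow, ZMod.isQuadratic_χ₄.sq_eq_one, MulChar.ringHomComp_one]

lemma chi4_neg_one : chi4 (-1) = -1 := by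
  have : ZMod.χ₄ (-1) = -1 := by decide
  simp [chi4, this]

lemma Gamma0_mul_apply_one_one {N : ℕ} {γ δ : SL(2, ℤ)}
    (hγ : γ ∈ CongruenceSubgroup.Gamma0 N) (hδ : δ ∈ CongruenceSubgroup.Gamma0 N) :
    (((γ * δ) 1 1 : ℤ) : ZMod N) = ((γ 1 1 : ℤ) : ZMod N) * ((δ 1 1 : ℤ) : ZMod N) :=
  map_mul (CongruenceSubgroup.Gamma0Map N) ⟨γ, hγ⟩ ⟨δ, hδ⟩

/-- The elements of `Γ₀(4)` under which `θ²` transforms with the character modulo `4`. -/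
def thetaGroup : Subgroup SL(2, ℤ) where
  carrier := {γ | γ ∈ CongruenceSubgroup.Gamma0 4 ∧
    thetaSq ∣[(1 : ℤ)] γ = chi4 ((γ 1 1 : ℤ) : ZMod 4) • thetaSq}
  mul_mem' := by
    rintro γ δ ⟨hγ, h1⟩ ⟨hδ, h2⟩
    refine ⟨mul_mem hγ hδ, ?_⟩
    rw [SlashAction.slash_mul, h1, ModularForm.SL_smul_slash, h2, smul_smul,
      Gamma0_mul_apply_one_one hγ hδ, map_mul]
  one_mem' := ⟨one_mem _, by simp⟩
  inv_mem' := by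
    rintro γ ⟨hγ, h⟩
    refine ⟨inv_mem hγ, ?_⟩
    have hχ : chi4 (((γ⁻¹) 1 1 : ℤ) : ZMod 4) * chi4 ((γ 1 1 : ℤ) : ZMod 4) = 1 := by
      rw [← map_mul, ← Gamma0_mul_apply_one_one (inv_mem hγ) hγ, inv_mul_cancel]
      simp
    have h' := congrArg (fun f => f ∣[(1 : ℤ)] γ⁻¹) h
    simp only [← SlashAction.slash_mul, mul_inv_cancel, SlashAction.slash_one,
      ModularForm.SL_smul_slash] at h'
    conv_rhs => rw [h']
    rw [smul_smul, hχ, one_smul]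

lemma mem_thetaGroup {γ : SL(2, ℤ)} : γ ∈ thetaGroup ↔ γ ∈ CongruenceSubgroup.Gamma0 4 ∧
    thetaSq ∣[(1 : ℤ)] γ = chi4 ((γ 1 1 : ℤ) : ZMod 4) • thetaSq := Iff.rfl

lemma T_mem_thetaGroup : ModularGroup.T ∈ thetaGroup := by
  refine mem_thetaGroup.mpr ⟨?_, ?_⟩
  · rw [CongruenceSubgroup.Gamma0_mem]
    simp [ModularGroup.T]
  · rw [hasQSeries_thetaSq.slash_T]
    simp [ModularGroup.T]

/-- In the odd weight 1 the slash by -1 is a sign, matched by χ₋₄(-1) = -1. -/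
lemma neg_one_mem_thetaGroup : -1 ∈ thetaGroup := by
  refine mem_thetaGroup.mpr ⟨?_, ?_⟩
  · simp [CongruenceSubgroup.Gamma0_mem]
  · funext τ
    rw [ModularForm.SL_slash_apply, ModularGroup.SL_neg_smul, one_smul, ModularGroup.denom_apply]
    simp [chi4_neg_one]

/-- The lower triangular matrix `(1, 0; 4m, 1)`. -/
def lowerFour (m : ℤ) : SL(2, ℤ) := ⟨!![1, 0; 4 * m, 1], by simp [Matrix.det_fin_two]⟩

lemma coe_lowerFour (m : ℤ) :
    (lowerFour m : Matrix (Fin 2) (Fin 2) ℤ) = !![1, 0; 4 * m, 1] := rfl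

lemma coe_lowerFour_smul (m : ℤ) (τ : ℍ) :
    ((lowerFour m • τ : ℍ) : ℂ) = τ / (4 * m * τ + 1) := by
  rw [UpperHalfPlane.specialLinearGroup_apply]
  simp [lowerFour]

lemma thetaSq_lowerFour_smul (m : ℤ) (τ : ℍ) :
    thetaSq (lowerFour m • τ) = (4 * m * τ + 1) * thetaSq τ := by
  have hτ : (τ : ℂ) ≠ 0 := τ.ne_zero
  have hd : (4 * m * τ + 1 : ℂ) ≠ 0 := by
    have := UpperHalfPlane.denom_ne_zero (lowerFour m) τ
    rw [ModularGroup.denom_apply] at this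
    simpa [lowerFour] using this
  have hinv : 0 < (-1 / (2 * (τ : ℂ))).im := by
    have h := (UpperHalfPlane.mk (2 * (τ : ℂ)) (two_mul_im_pos τ)).im_inv_neg_coe_pos
    simpa [neg_div, neg_inv, inv_neg] using h
  -- On 2τ the matrix acts as inversion, translation by -2m, inversion. Squares of theta avoid any
  -- choice of root, and (-i)² · 2τu = 4mτ + 1.
  set u : ℂ := (-m : ℤ) * 2 + -1 / (2 * (τ : ℂ)) with hu
  have hui : 0 < u.im := by
    have : u.im = (-1 / (2 * (τ : ℂ))).im := by
      rw [hu, add_im]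
      simp
    rwa [this]
  have hu0 : u = -(4 * m * τ + 1) / (2 * τ) := by
    rw [hu]
    push_cast
    field_simp
    ring
  have hw : 2 * ((lowerFour m • τ : ℍ) : ℂ) = -1 / u := by
    rw [coe_lowerFour_smul, hu0]
    field_simp
  simp only [thetaSq, Pi.pow_apply, thetaFun]
  rw [hw, jacobiTheta_neg_inv_sq hui, hu, jacobiTheta_int_mul_two_add, ← hu,
    jacobiTheta_neg_inv_sq (two_mul_im_pos τ), hu0]
  field_simp
  rw [I_sq]
  ring

lemma lowerFour_mem_thetaGroup (m : ℤ) : lowerFour m ∈ thetaGroup := by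
  refine mem_thetaGroup.mpr ⟨?_, ?_⟩
  · rw [CongruenceSubgroup.Gamma0_mem]
    have : (4 : ZMod 4) = 0 := by decide
    simp [lowerFour, this]
  · funext τ
    have hd := UpperHalfPlane.denom_ne_zero (lowerFour m) τ
    rw [ModularForm.SL_slash_apply, thetaSq_lowerFour_smul]
    rw [ModularGroup.denom_apply] at hd ⊢
    simp only [lowerFour] at hd ⊢
    simp at hd ⊢
    field_simp

lemma exists_two_mul_abs_add_mul_le {c : ℤ} (hc : c ≠ 0) (d : ℤ) :
    ∃ m : ℤ, 2 * |d + m * c| ≤ |c| := by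
  have h0 := Int.emod_nonneg d hc
  have h1 := Int.emod_lt_abs d hc
  have h2 := Int.emod_add_mul_ediv d c
  rcases le_or_gt (2 * (d % c)) |c| with h | h
  · refine ⟨-(d / c), ?_⟩
    rw [show d + -(d / c) * c = d % c by linarith, abs_of_nonneg h0]
    exact h
  · refine ⟨-(d / c) - c.sign, ?_⟩
    have h3 : c.sign * c = |c| := Int.sign_mul_self_eq_abs c
    rw [show d + (-(d / c) - c.sign) * c = d % c - |c| by linarith, abs_of_neg (by linarith)]
    linarith

/-- Descent on |c|: a power of T makes 2|d| ≤ |c|, then a `lowerFour` makes |c'| ≤ 2|d|. As d is odd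
and 4 ∣ c, equality 2|d| = |c| is impossible, so |c'| < |c|. At c = 0 only ±T^b remain. -/
lemma Gamma0_four_le_thetaGroup : CongruenceSubgroup.Gamma0 4 ≤ thetaGroup := by
  intro γ hγ
  induction hn : (γ 1 0).natAbs using Nat.strong_induction_on generalizing γ with
  | _ n ih =>
  have hdet := γ.det_coe
  rw [Matrix.det_fin_two] at hdet
  have h4 : (4 : ℤ) ∣ γ 1 0 := by
    rw [CongruenceSubgroup.Gamma0_mem] at hγ
    exact (ZMod.intCast_zmod_eq_zero_iff_dvd _ 4).mp hγ
  obtain ⟨c, hc⟩ := h4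
  rcases eq_or_ne (γ 1 0) 0 with h0 | h0
  · rw [h0, mul_zero, sub_zero] at hdet
    rcases Int.eq_one_or_neg_one_of_mul_eq_one' hdet with ⟨ha, hd⟩ | ⟨ha, hd⟩
    · have : γ = ModularGroup.T ^ (γ 0 1) := by
        ext i j
        rw [ModularGroup.coe_T_zpow]
        fin_cases i <;> fin_cases j <;> simp [ha, hd, h0]
      rw [this]
      exact zpow_mem T_mem_thetaGroup _
    · have : γ = -1 * ModularGroup.T ^ (-(γ 0 1)) := by
        ext i j
        rw [neg_one_mul, Matrix.SpecialLinearGroup.coe_neg, ModularGroup.coe_T_zpow]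
        fin_cases i <;> fin_cases j <;> simp [ha, hd, h0]
      rw [this]
      exact mul_mem neg_one_mem_thetaGroup (zpow_mem T_mem_thetaGroup _)
  · obtain ⟨m, hm⟩ := exists_two_mul_abs_add_mul_le h0 (γ 1 1)
    have hodd : ¬ (2 : ℤ) ∣ γ 1 1 + m * γ 1 0 := by
      rintro ⟨e, he⟩
      have h1 : γ 1 1 = 2 * (e - 2 * m * c) := by
        rw [hc] at he
        linarith
      rw [hc, h1] at hdet
      have : 2 * (γ 0 0 * (e - 2 * m * c) - γ 0 1 * (2 * c)) = 1 := by linarith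
      omega
    have hd0 : γ 1 1 + m * γ 1 0 ≠ 0 := fun h => hodd (h ▸ dvd_zero 2)
    obtain ⟨l, hl⟩ := exists_two_mul_abs_add_mul_le (c := 4 * (γ 1 1 + m * γ 1 0))
      (by omega) (γ 1 0)
    set δ := γ * ModularGroup.T ^ m * lowerFour l with hδ
    have hδc : δ 1 0 = γ 1 0 + l * (4 * (γ 1 1 + m * γ 1 0)) := by
      rw [hδ, Matrix.SpecialLinearGroup.coe_mul, Matrix.SpecialLinearGroup.coe_mul,
        ModularGroup.coe_T_zpow, coe_lowerFour]
      simp [Matrix.mul_apply, Fin.sum_univ_two]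
      ring
    have hTm : ModularGroup.T ^ m ∈ thetaGroup := zpow_mem T_mem_thetaGroup m
    have hδmem : δ ∈ thetaGroup := by
      refine ih _ ?_ (mul_mem (mul_mem hγ hTm.1) (lowerFour_mem_thetaGroup l).1) rfl
      rw [hδc, ← hn]
      zify
      rw [abs_mul] at hl
      rw [hc] at hm hodd hl ⊢
      rw [hc] at h0
      rcases abs_cases (γ 1 1 + m * (4 * c)) with ⟨e1, _⟩ | ⟨e1, _⟩ <;>
      rcases abs_cases (4 * c) with ⟨e2, _⟩ | ⟨e2, _⟩ <;>
      · rw [e1, e2] at hm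
        rw [e1] at hl
        rw [e2]
        norm_num at hl
        omega
    have : γ = δ * (lowerFour l)⁻¹ * (ModularGroup.T ^ m)⁻¹ := by
      rw [hδ]
      group
    rw [this]
    exact mul_mem (mul_mem hδmem (inv_mem (lowerFour_mem_thetaGroup l))) (inv_mem hTm)

/-! ### Growth of the theta series at the cusps -/

/-- On the imaginary axis each term equals the norm of the corresponding term at τ, so this is the
triangle inequality. -/
lemma norm_jacobiTheta_le_imaginary_axis {τ : ℂ} (hτ : 0 < τ.im) :
    ‖jacobiTheta τ‖ ≤ ‖jacobiTheta (I * τ.im)‖ := by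
  have hterm (n : ℤ) : cexp (Real.pi * I * (n : ℂ) ^ 2 * (I * τ.im)) =
      ((‖cexp (Real.pi * I * (n : ℂ) ^ 2 * τ)‖ : ℝ) : ℂ) := by
    rw [norm_exp, ofReal_exp]
    congr 1
    have : (Real.pi * I * (n : ℂ) ^ 2 * τ : ℂ) = ((Real.pi * n ^ 2 : ℝ) : ℂ) * (I * τ) := by
      push_cast
      ring
    rw [this, re_ofReal_mul, I_mul_re]
    push_cast
    linear_combination (Real.pi : ℂ) * n ^ 2 * τ.im * I_sq
  have hs : Summable fun n : ℤ => ‖cexp (Real.pi * I * (n : ℂ) ^ 2 * τ)‖ := by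
    have := (hasSum_jacobiTheta₂_term 0 hτ).summable.norm
    simpa [jacobiTheta₂_term] using this
  rw [jacobiTheta, jacobiTheta, tsum_congr hterm, ← ofReal_tsum, norm_real]
  exact (norm_tsum_le_tsum_norm hs).trans (Real.le_norm_self _)

lemma exists_norm_jacobiTheta_le_of_one_le_im :
    ∃ K : ℝ, 0 ≤ K ∧ ∀ τ : ℂ, 1 ≤ τ.im → ‖jacobiTheta τ‖ ≤ K := by
  have hpi := Real.pi_pos
  have h1 : Real.exp (-Real.pi) < 1 := by
    rw [← Real.exp_zero]
    exact Real.exp_lt_exp.mpr (by linarith)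
  refine ⟨2 / (1 - Real.exp (-Real.pi)) + 1, by
    have : 0 < 1 - Real.exp (-Real.pi) := by linarith
    positivity, fun τ hτ => ?_⟩
  have h := norm_jacobiTheta_sub_one_le (zero_lt_one.trans_le hτ)
  have h2 : Real.exp (-Real.pi * τ.im) ≤ Real.exp (-Real.pi) :=
    Real.exp_le_exp.mpr (by nlinarith)
  have h3 : 2 / (1 - Real.exp (-Real.pi * τ.im)) * Real.exp (-Real.pi * τ.im) ≤
      2 / (1 - Real.exp (-Real.pi)) * 1 := by
    have : 0 < 1 - Real.exp (-Real.pi) := by linarith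
    gcongr
    linarith
  have h4 := norm_add_le (jacobiTheta τ - 1) 1
  rw [sub_add_cancel, norm_one] at h4
  linarith

/-- For Im τ < 1, pass to the imaginary axis and invert: iy goes to i/y at the cost of a factor 1/y.
-/
lemma exists_norm_jacobiTheta_sq_le :
    ∃ C : ℝ, 0 ≤ C ∧ ∀ τ : ℂ, 0 < τ.im → ‖jacobiTheta τ ^ 2‖ ≤ C * (1 + 1 / τ.im) := by
  obtain ⟨K, hK, h⟩ := exists_norm_jacobiTheta_le_of_one_le_im
  refine ⟨K ^ 2, by positivity, fun τ hτ => ?_⟩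
  have hinv : 0 < 1 / τ.im := by positivity
  rcases le_or_gt 1 τ.im with h1 | h1
  · rw [norm_pow]
    calc ‖jacobiTheta τ‖ ^ 2 ≤ K ^ 2 := by gcongr; exact h τ h1
      _ ≤ K ^ 2 * (1 + 1 / τ.im) := le_mul_of_one_le_right (by positivity) (by linarith)
  · have hy : (τ.im : ℂ) ≠ 0 := by exact_mod_cast hτ.ne'
    have hS := jacobiTheta_neg_inv_sq (w := I * τ.im) (by simpa using hτ)
    have hI : -1 / (I * (τ.im : ℂ)) = I * (1 / τ.im : ℝ) := by
      push_cast
      field_simp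
      rw [I_sq]
    have hII : -I * (I * (τ.im : ℂ)) = τ.im := by linear_combination -(τ.im : ℂ) * I_sq
    rw [hI, hII] at hS
    have hle := h (I * (1 / τ.im : ℝ)) (by simpa using (one_le_inv₀ hτ).mpr h1.le)
    have hnorm := congrArg norm hS
    rw [norm_mul, norm_real, Real.norm_of_nonneg hτ.le, norm_pow, norm_pow] at hnorm
    have haxis := norm_jacobiTheta_le_imaginary_axis hτ
    have hsq : ‖jacobiTheta (I * τ.im)‖ ^ 2 ≤ K ^ 2 * (1 / τ.im) := by
      rw [mul_one_div, le_div_iff₀ hτ, mul_comm, ← hnorm]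
      gcongr
    rw [norm_pow]
    calc ‖jacobiTheta τ‖ ^ 2 ≤ ‖jacobiTheta (I * τ.im)‖ ^ 2 := by gcongr
      _ ≤ K ^ 2 * (1 / τ.im) := hsq
      _ ≤ K ^ 2 * (1 + 1 / τ.im) := by gcongr; linarith

lemma one_le_norm_denom (γ : SL(2, ℤ)) {τ : ℍ} (hτ : 1 ≤ τ.im) :
    1 ≤ ‖UpperHalfPlane.denom γ τ‖ := by
  rw [ModularGroup.denom_apply]
  rcases eq_or_ne (γ 1 0) 0 with h0 | h0
  · have hdet := γ.det_coe
    rw [Matrix.det_fin_two, h0, mul_zero, sub_zero] at hdet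
    have hd : γ 1 1 ≠ 0 := fun h => by simp [h] at hdet
    rw [h0, Int.cast_zero, zero_mul, zero_add, norm_intCast]
    exact_mod_cast Int.one_le_abs hd
  · refine le_trans ?_ (abs_im_le_norm _)
    have h1 : (1 : ℝ) ≤ |(γ 1 0 : ℝ)| := by exact_mod_cast Int.one_le_abs h0
    have h2 : ((γ 1 0 : ℂ) * τ + γ 1 1).im = (γ 1 0 : ℝ) * τ.im := by simp
    rw [h2, abs_mul, abs_of_pos τ.im_pos]
    nlinarith

/-- Γ(4) is normal in SL(2, ℤ) and lies in Γ₀(4) with d ≡ 1, so conjugates of T⁴ fix θ². -/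
lemma thetaSq_slash_T_four_zpow (γ : SL(2, ℤ)) (m : ℤ) :
    (thetaSq ∣[(1 : ℤ)] γ) ∣[(1 : ℤ)] (ModularGroup.T ^ (4 * m)) = thetaSq ∣[(1 : ℤ)] γ := by
  have hmem : γ * ModularGroup.T ^ (4 * m) * γ⁻¹ ∈ CongruenceSubgroup.Gamma 4 :=
    (CongruenceSubgroup.Gamma_normal 4).conj_mem _
      (CongruenceSubgroup.ModularGroup_T_pow_mem_Gamma 4 (4 * m) (dvd_mul_right _ _)) γ
  obtain ⟨-, -, h10, h11⟩ := CongruenceSubgroup.Gamma_mem.mp hmem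
  have h := (Gamma0_four_le_thetaGroup (CongruenceSubgroup.Gamma0_mem.mpr h10)).2
  rw [h11, map_one, one_smul] at h
  rw [← SlashAction.slash_mul, show γ * ModularGroup.T ^ (4 * m) =
    γ * ModularGroup.T ^ (4 * m) * γ⁻¹ * γ by group, SlashAction.slash_mul, h]

lemma thetaSq_slash_four_periodic (γ : SL(2, ℤ)) (m : ℤ) (τ : ℍ) :
    (thetaSq ∣[(1 : ℤ)] γ) (ModularGroup.T ^ (4 * m) • τ) = (thetaSq ∣[(1 : ℤ)] γ) τ := by
  have h := congrFun (thetaSq_slash_T_four_zpow γ m) τ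
  rw [ModularForm.SL_slash_apply (thetaSq ∣[(1 : ℤ)] γ), ModularGroup.denom_apply,
    ModularGroup.coe_T_zpow] at h
  simpa using h

lemma isBoundedAtImInfty_thetaSq_slash (γ : SL(2, ℤ)) :
    UpperHalfPlane.IsBoundedAtImInfty (thetaSq ∣[(1 : ℤ)] γ) := by
  obtain ⟨C, hC, hθ⟩ := exists_norm_jacobiTheta_sq_le
  rw [UpperHalfPlane.isBoundedAtImInfty_iff]
  -- After translation 0 ≤ Re σ < 4 and Im σ ≥ 1, so |σ| ≤ 5 Im σ; this is the 5.
  refine ⟨C * (1 + (5 * |(γ 1 0 : ℝ)| + |(γ 1 1 : ℝ)|)), 1, fun τ hτ => ?_⟩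
  obtain ⟨m, hm0, hm1⟩ : ∃ m : ℤ, 0 ≤ τ.re + 4 * m ∧ τ.re + 4 * m < 4 := by
    refine ⟨-⌊τ.re / 4⌋, ?_, ?_⟩
    · have := Int.floor_le (τ.re / 4)
      push_cast
      linarith
    · have := Int.lt_floor_add_one (τ.re / 4)
      push_cast
      linarith
  rw [← thetaSq_slash_four_periodic γ m τ]
  set σ : ℍ := ModularGroup.T ^ (4 * m) • τ with hσ
  have hσc : (σ : ℂ) = τ + 4 * m := by
    rw [hσ, UpperHalfPlane.modular_T_zpow_smul, UpperHalfPlane.coe_vadd]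
    push_cast
    ring
  have him : σ.im = τ.im := by
    rw [← UpperHalfPlane.coe_im, hσc]
    simp
  have hre : σ.re = τ.re + 4 * m := by
    rw [← UpperHalfPlane.coe_re, hσc]
    simp
  rw [← him] at hτ
  rw [← hre] at hm0 hm1
  have hd1 := one_le_norm_denom γ hτ
  have hd2 : ‖UpperHalfPlane.denom γ σ‖ ≤ (5 * |(γ 1 0 : ℝ)| + |(γ 1 1 : ℝ)|) * σ.im := by
    rw [ModularGroup.denom_apply]
    have h1 := norm_add_le ((γ 1 0 : ℂ) * σ) (γ 1 1 : ℂ)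
    rw [norm_mul, norm_intCast, norm_intCast] at h1
    have h2 := norm_le_abs_re_add_abs_im (σ : ℂ)
    rw [UpperHalfPlane.coe_re, UpperHalfPlane.coe_im, abs_of_nonneg hm0,
      abs_of_pos σ.im_pos] at h2
    have h3 := abs_nonneg (γ 1 0 : ℝ)
    have h4 := abs_nonneg (γ 1 1 : ℝ)
    nlinarith
  have hbound := hθ (2 * ((γ • σ : ℍ) : ℂ)) (two_mul_im_pos _)
  have him2 : (2 * ((γ • σ : ℍ) : ℂ)).im = 2 * σ.im / ‖UpperHalfPlane.denom γ σ‖ ^ 2 := by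
    have := ModularGroup.im_smul_eq_div_normSq γ σ
    rw [Complex.normSq_eq_norm_sq] at this
    have h2 : (2 * ((γ • σ : ℍ) : ℂ)).im = 2 * (γ • σ : ℍ).im := by simp
    rw [h2, this]
    ring
  rw [him2] at hbound
  rw [ModularForm.SL_slash_apply, norm_mul, zpow_neg_one, norm_inv, ← div_eq_mul_inv]
  have hσ0 := σ.im_pos
  generalize ‖UpperHalfPlane.denom γ σ‖ = δ at hd1 hd2 hbound ⊢
  have hδ : 0 < δ := by linarith
  rw [div_le_iff₀ hδ]
  refine hbound.trans ?_
  rw [mul_assoc]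
  -- With δ = |cσ+d| ≥ 1 and δ ≤ M Im σ, the claim is 1 + δ²/(2 Im σ) ≤ (1 + M) δ.
  refine mul_le_mul_of_nonneg_left ?_ hC
  have h5 : δ / σ.im ≤ 5 * |(γ 1 0 : ℝ)| + |(γ 1 1 : ℝ)| := (div_le_iff₀ hσ0).mpr hd2
  have h6 : 1 / (2 * σ.im / δ ^ 2) = δ / σ.im * δ / 2 := by
    field_simp
  rw [h6]
  have h7 : 0 < δ / σ.im := by positivity
  nlinarith

lemma isQuasimodularForm_thetaSq : IsQuasimodularForm 4 chi4 1 thetaSq :=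
  isQuasimodularForm_of_slash hasQSeries_thetaSq.mdifferentiable
    (fun _ hγ => (Gamma0_four_le_thetaGroup hγ).2) isBoundedAtImInfty_thetaSq_slash

/-! ### The quasimodular forms `Y_n` -/

lemma coeff_Omega_two_mul (k : ℕ) :
    PowerSeries.coeff (2 * k) Omega =
      PowerSeries.C (1 / ((2 * k + 1).factorial : ℂ)) * ramanujanU (2 * k) := by
  rw [Omega, PowerSeries.coeff_mk, if_pos (even_two_mul k)]

lemma coeff_Omega_of_odd {m : ℕ} (hm : ¬ Even m) : PowerSeries.coeff m Omega = 0 := by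
  rw [Omega, PowerSeries.coeff_mk, if_neg hm]

lemma factorial_mul_inv_factorials {n k : ℕ} (hk : 2 * k ≤ n) :
    (n.factorial : ℂ) * (1 / ((n - 2 * k).factorial : ℂ)) * (1 / ((2 * k + 1).factorial : ℂ)) =
      ((n + 1).choose (2 * k + 1) : ℂ) / (n + 1) := by
  have h := Nat.choose_mul_factorial_mul_factorial (n := n + 1) (k := 2 * k + 1) (by omega)
  rw [show n + 1 - (2 * k + 1) = n - 2 * k by omega, Nat.factorial_succ n] at h
  have h' := congrArg (Nat.cast : ℕ → ℂ) h
  push_cast at h'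
  have h1 : ((n - 2 * k).factorial : ℂ) ≠ 0 := by exact_mod_cast Nat.factorial_ne_zero _
  have h2 : ((2 * k + 1).factorial : ℂ) ≠ 0 := by exact_mod_cast Nat.factorial_ne_zero _
  have h3 : (n + 1 : ℂ) ≠ 0 := by exact_mod_cast n.succ_ne_zero
  field_simp
  linear_combination -h'

lemma coeff_generatingSeries (n : ℕ) :
    PowerSeries.coeff n generatingSeries = ∑ k ∈ Finset.range (n / 2 + 1),
      ((PowerSeries.C (1 / 2 : ℂ) * theta ^ 2) ^ (n - 2 * k) *
        PowerSeries.C (1 / ((n - 2 * k).factorial : ℂ))) *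
        (PowerSeries.C (1 / 2 : ℂ) ^ (2 * k) *
          (PowerSeries.C (1 / ((2 * k + 1).factorial : ℂ)) * ramanujanU (2 * k))) := by
  have hexp (i : ℕ) : PowerSeries.coeff i (PowerSeries.exp ℂ⟦X⟧) =
      PowerSeries.C (1 / (i.factorial : ℂ)) := by
    rw [PowerSeries.coeff_exp, PowerSeries.algebraMap_apply]
    simp
  rw [generatingSeries, PowerSeries.coeff_mul]
  symm
  -- Antidiagonal pairs outside the image of k ↦ (n-2k, 2k) have odd second index, where Ω has no
  -- coefficient.
  refine Finset.sum_of_injOn (fun k => (n - 2 * k, 2 * k)) ?_ ?_ ?_ ?_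
  · intro a _ b _ h
    have := congrArg Prod.snd h
    simpa using this
  · intro k hk
    have := Finset.mem_range.mp (Finset.mem_coe.mp hk)
    refine Finset.mem_coe.mpr (Finset.HasAntidiagonal.mem_antidiagonal.mpr ?_)
    change n - 2 * k + 2 * k = n
    omega
  · rintro ⟨i, j⟩ hij hnot
    have hsum : i + j = n := Finset.HasAntidiagonal.mem_antidiagonal.mp hij
    have hodd : ¬ Even j := by
      rintro ⟨k, rfl⟩
      refine hnot ⟨k, ?_, ?_⟩
      · exact Finset.mem_coe.mpr (Finset.mem_range.mpr (by omega))
      · simp only [Prod.mk.injEq]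
        omega
    rw [PowerSeries.coeff_rescale _ _ j, coeff_Omega_of_odd hodd, mul_zero, mul_zero]
  · intro k _
    rw [PowerSeries.coeff_rescale, PowerSeries.coeff_rescale, hexp, coeff_Omega_two_mul]

/-- The explicit formula for `Y_n`. -/
lemma Y_eq_sum (n : ℕ) :
    Y n = PowerSeries.C (1 / ((2 : ℂ) ^ n * ((n : ℂ) + 1))) *
      ∑ k ∈ Finset.range (n / 2 + 1),
        ((n + 1).choose (2 * k + 1) : ℂ⟦X⟧) * theta ^ (2 * n - 4 * k) * ramanujanU (2 * k) := by
  rw [Y, coeff_generatingSeries, Finset.mul_sum, Finset.mul_sum]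
  refine Finset.sum_congr rfl fun k hk => ?_
  have hk' : 2 * k ≤ n := by
    have := Finset.mem_range.mp hk
    omega
  have hC : (PowerSeries.C ((n.factorial : ℂ) * (1 / ((n - 2 * k).factorial : ℂ)) *
      (1 / ((2 * k + 1).factorial : ℂ)) * (1 / 2) ^ n) : ℂ⟦X⟧) =
      PowerSeries.C (1 / ((2 : ℂ) ^ n * ((n : ℂ) + 1)) * ((n + 1).choose (2 * k + 1) : ℂ)) := by
    rw [factorial_mul_inv_factorials hk', one_div_pow]
    congr 1
    field_simp
  have hpow : (PowerSeries.C (1 / 2 : ℂ) : ℂ⟦X⟧) ^ (n - 2 * k) *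
      PowerSeries.C (1 / 2 : ℂ) ^ (2 * k) = PowerSeries.C ((1 / 2 : ℂ) ^ n) := by
    rw [← pow_add, Nat.sub_add_cancel hk', map_pow]
  rw [map_mul _ _ ((1 / 2 : ℂ) ^ n), ← hpow] at hC
  simp only [map_mul, map_natCast] at hC
  rw [mul_pow, ← pow_mul, show 2 * (n - 2 * k) = 2 * n - 4 * k by omega]
  linear_combination theta ^ (2 * n - 4 * k) * ramanujanU (2 * k) * hC

lemma constantCoeff_theta : PowerSeries.constantCoeff theta = 1 := by
  rw [← PowerSeries.coeff_zero_eq_constantCoeff_apply, theta, PowerSeries.coeff_mk, if_pos rfl]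

/-- The odd binomial coefficients `C(n+1, 2k+1)` sum to `2^n`. -/
lemma sum_choose_odd (n : ℕ) :
    ∑ k ∈ Finset.range (n / 2 + 1), (n + 1).choose (2 * k + 1) = 2 ^ n := by
  have hpair (a : ℕ → ℕ) (m : ℕ) : ∑ k ∈ Finset.range m, (a (2 * k) + a (2 * k + 1)) =
      ∑ j ∈ Finset.range (2 * m), a j := by
    induction m with
    | zero => simp
    | succ m ih =>
      rw [Finset.sum_range_succ, ih, mul_add_one, Finset.sum_range_succ, Finset.sum_range_succ,
        add_assoc]
  -- Pascal's rule turns the sum into the full row n; for even n the range overshoots by one zero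
  -- term.
  simp only [Nat.choose_succ_succ]
  rw [hpair, ← Nat.sum_range_choose n]
  refine (Finset.sum_subset (Finset.range_subset_range.mpr (by omega)) fun j _ hj => ?_).symm
  exact Nat.choose_eq_zero_of_lt (by simpa using hj)

lemma constantCoeff_Y (n : ℕ) : PowerSeries.constantCoeff (Y n) = 1 / ((n : ℂ) + 1) := by
  have h := congrArg (Nat.cast : ℕ → ℂ) (sum_choose_odd n)
  push_cast at h
  have h1 : (n + 1 : ℂ) ≠ 0 := by exact_mod_cast n.succ_ne_zero
  rw [Y_eq_sum]
  simp only [map_mul, map_sum, map_pow, map_natCast, constantCoeff_theta,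
    constantCoeff_ramanujanU, PowerSeries.constantCoeff_C, one_pow, mul_one, h]
  field_simp

lemma isQuasimodularGamma0Four_Y (n : ℕ) : IsQuasimodularGamma0Four n (Y n) := by
  choose u hu hP using exists_hasQSeries_ramanujanU
  have hone : IsQuasimodularForm 4 1 0 1 := isQuasimodularForm_const 4 1
  have hconst (c : ℂ) {χ : DirichletCharacter ℂ 4} {k : ℤ} {f : ℍ → ℂ}
      (hf : IsQuasimodularForm 4 χ k f) : IsQuasimodularForm 4 χ k (c • f) := by
    have := (isQuasimodularForm_const 4 c).mul hf
    rw [one_mul, zero_add] at this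
    exact this
  -- Since χ₋₄² = 1, all summands carry the same character.
  have hχ {k : ℕ} (hk : 2 * k ≤ n) : chi4 ^ (n - 2 * k) = chi4 ^ n := by
    conv_rhs => rw [← Nat.sub_add_cancel hk, pow_add, pow_mul, chi4_sq, one_pow, mul_one]
  have hterm (k : ℕ) (hk : 2 * k ≤ n) :
      IsQuasimodularForm 4 (chi4 ^ n) n (thetaSq ^ (n - 2 * k) * u k) := by
    have h := (isQuasimodularForm_thetaSq.pow hone (n - 2 * k)).mul ((hP k).isQuasimodularForm 4)
    rw [hχ hk, mul_one, mul_one, ← Nat.cast_add, Nat.sub_add_cancel hk] at h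
    exact h
  have hzero : IsQuasimodularForm 4 (chi4 ^ n) n 0 := by
    simpa using hconst 0 (hterm 0 (Nat.zero_le n))
  refine ⟨(1 / ((2 : ℂ) ^ n * ((n : ℂ) + 1))) • ∑ k ∈ Finset.range (n / 2 + 1),
    ((n + 1).choose (2 * k + 1) : ℂ) • (thetaSq ^ (n - 2 * k) * u k), ?_, ?_⟩
  · have hsum (s : Finset ℕ) : HasQSeries
        (∑ k ∈ s, PowerSeries.C ((n + 1).choose (2 * k + 1) : ℂ) *
          ((theta ^ 2) ^ (n - 2 * k) * ramanujanU (2 * k)))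
        (∑ k ∈ s, ((n + 1).choose (2 * k + 1) : ℂ) • (thetaSq ^ (n - 2 * k) * u k)) := by
      induction s using Finset.induction_on with
      | empty => simpa using! HasQSeries.const 0
      | insert k s hk ih =>
        rw [Finset.sum_insert hk, Finset.sum_insert hk]
        exact (((hasQSeries_thetaSq.pow _).mul (hu k)).C_mul _).add ih
    have h := (hsum (Finset.range (n / 2 + 1))).C_mul (1 / ((2 : ℂ) ^ n * ((n : ℂ) + 1)))
    have hY : Y n = PowerSeries.C (1 / ((2 : ℂ) ^ n * ((n : ℂ) + 1))) *
        ∑ k ∈ Finset.range (n / 2 + 1), PowerSeries.C ((n + 1).choose (2 * k + 1) : ℂ) *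
          ((theta ^ 2) ^ (n - 2 * k) * ramanujanU (2 * k)) := by
      rw [Y_eq_sum]
      congr 1
      refine Finset.sum_congr rfl fun k _ => ?_
      rw [map_natCast, ← pow_mul, mul_assoc, show 2 * (n - 2 * k) = 2 * n - 4 * k by omega]
    rw [hY]
    exact h
  · refine hconst _ (IsQuasimodularForm.sum hzero fun k hk => hconst _ (hterm k ?_))
    have := Finset.mem_range.mp hk
    omega

end QuasiTheta

end

theorem theorem1p1 (n : ℕ) :
    (PowerSeries.constantCoeff (QuasiTheta.Y n) = 1 / ((n : ℂ) + 1) ∧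
      QuasiTheta.IsQuasimodularGamma0Four n (QuasiTheta.Y n)) ∧
    QuasiTheta.Y n =
      PowerSeries.C (1 / ((2 : ℂ) ^ n * ((n : ℂ) + 1))) *
        ∑ k ∈ Finset.range (n / 2 + 1),
          ((n + 1).choose (2 * k + 1) : ℂ⟦X⟧) * QuasiTheta.theta ^ (2 * n - 4 * k) *
            QuasiTheta.ramanujanU (2 * k) :=
  ⟨⟨QuasiTheta.constantCoeff_Y n, QuasiTheta.isQuasimodularGamma0Four_Y n⟩, QuasiTheta.Y_eq_sum n⟩
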